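/- Let $k$ be a field and $H=(H,\Delta,\varepsilon,\phi,S,\alpha,\beta)$ a finite dimensional quasi-Hopf algebra over $k$: $H$ is an associative unital algebra, $\Delta:H\to H\otimes H$, $\Delta(h)=h_1\otimes h_2$, and $\varepsilon:H\to k$ are algebra morphisms, $\phi=X^1\otimes X^2\otimes X^3\in H^{\otimes 3}$ is invertible with inverse $\phi^{-1}=x^1\otimes x^2\otimes x^3$, and $$\phi(\Delta\otimes I)\Delta(h)\phi^{-1}=(I\otimes\Delta)\Delta(h),\qquad (I\otimes\varepsilon)\Delta(h)=(\varepsilon\otimes I)\Delta(h)=h,$$ $$(I\otimes I\otimes\Delta)(\phi)(\Delta\otimes I\otimes I)(\phi)=(1\otimes\phi)(I\otimes\Delta\otimes I)(\phi)(\phi\otimes1),\qquad (I\otimes\varepsilon\otimes I)(\phi)=1\otimes1;$$ $S:H\to H$ is a (unital) anti-algebra morphism and $\alpha,\beta\in H$ satisfy $S(h_1)\alpha h_2=\varepsilon(h)\alpha$, $h_1\beta S(h_2)=\varepsilon(h)\beta$, $X^1\beta S(X^2)\alpha X^3=1$, $S(x^1)\alpha x^2\beta S(x^3)=1$. (Since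 $\dim_k H<\infty$, $S$ is bijective.) Put $p_L=X^2S^{-1}(X^1\beta)\otimes X^3$ and $q_L=S(x^1)\alpha x^2\otimes x^3$. Let $t\in H$ be a nonzero left integral, i.e. $ht=\varepsilon(h)t$ for all $h\in H$, and let $\gamma:H\to k$ be the modular element, the unique algebra morphism with $th=\gamma(h)t$ for all $h\in H$. Put $\Lambda=\gamma(q_L^2)q_L^1$ and $\gamma\rightharpoonup h=\gamma(h_2)h_1$. Let $A$ be a left $H$-module algebra: a left $H$-module with a $k$-bilinear, not necessarily associative, multiplication and a two-sided unit $1_A$ such that $(ab)c=(X^1\cdot a)[(X^2\cdot b)(X^3\cdot c)]$, $h\cdot(ab)=(h_1\cdot a)(h_2\cdot b)$ and $h\cdot1_A=\varepsilon(h)1_A$. Let $B=A^H=\{a\in A: h\cdot a=\varepsilon(h)a\ \text{for all } h\in H\}$, and let $A\#H$ be the smash product, i.e. $A\otimes H$ with multiplication $(a\#h)(b\#g)=(x^1\cdot a)(x^2h_1\cdot b)\#x^3h_2g$. It acts on $A$ from the left by $(a\#h)b=a(h\cdot b)$ and from the right by $$a\cdot_\gamma(b\#h)=S^{-1}\big(S(X^2)\Lambda(\gamma\rightharpoonup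 X^3h)\big)\cdot\big[(p_L^1S^{-1}(X^1)\cdot a)(p_L^2\cdot b)\big].$$ Then there is a well-defined linear map (the Morita map) $$(-,-):A\otimes_{A\#H}A\to B,\qquad (a,b)=t\cdot[(p_L^1\cdot a)(p_L^2\cdot b)],$$ and the following statements are equivalent: 1. the Morita map $(-,-)$ is surjective; 2. there is a total integral for $A$, i.e. a left $H$-linear map $\Phi:H^*\to A$ with $\Phi(\varepsilon)=1_A$, where $H$ acts on $H^*$ by $(h\rightharpoonup h^*)(g)=h^*(gh)$; 3. $A$ has an element of trace one, i.e. there is $a\in A$ with $t\cdot a=1_A$. -/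

import Mathlib

open scoped TensorProduct

noncomputable section

namespace QuasiHopf

universe u v w

/-- A quasi-bialgebra `(H, Δ, ε, φ)` over a field `k`. The associator `φ` is an invertible element
of `H ⊗ H ⊗ H`, which is bracketed to the right, as is `H ⊗ H ⊗ H ⊗ H`; the rebracketing
isomorphisms are written out. -/
class QuasiBialgebra (k : Type u) (H : Type v) [Field k] [Ring H] [Algebra k H] where
  /-- the coproduct `Δ` -/
  comul : H →ₐ[k] H ⊗[k] H
  /-- the counit `ε` -/
  counit : H →ₐ[k] k
  /-- the associator `φ = X¹ ⊗ X² ⊗ X³`, with inverse `φ⁻¹ = x¹ ⊗ x² ⊗ x³` -/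
  phi : (H ⊗[k] (H ⊗[k] H))ˣ
  /-- `φ (Δ ⊗ I)Δ(h) φ⁻¹ = (I ⊗ Δ)Δ(h)` -/
  coassoc : ∀ h : H,
    (phi : H ⊗[k] (H ⊗[k] H)) *
        TensorProduct.assoc k H H H (TensorProduct.map comul.toLinearMap LinearMap.id (comul h)) *
        ((phi⁻¹ : (H ⊗[k] (H ⊗[k] H))ˣ) : H ⊗[k] (H ⊗[k] H)) =
      TensorProduct.map LinearMap.id comul.toLinearMap (comul h)
  /-- `(I ⊗ ε)Δ(h) = h` -/
  counit_right : ∀ h : H,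
    TensorProduct.rid k H (TensorProduct.map LinearMap.id counit.toLinearMap (comul h)) = h
  /-- `(ε ⊗ I)Δ(h) = h` -/
  counit_left : ∀ h : H,
    TensorProduct.lid k H (TensorProduct.map counit.toLinearMap LinearMap.id (comul h)) = h
  /-- `(I ⊗ I ⊗ Δ)(φ) (Δ ⊗ I ⊗ I)(φ) = (1 ⊗ φ) (I ⊗ Δ ⊗ I)(φ) (φ ⊗ 1)` -/
  pentagon :
    (TensorProduct.map LinearMap.id (TensorProduct.map LinearMap.id comul.toLinearMap)
          (phi : H ⊗[k] (H ⊗[k] H)) : H ⊗[k] (H ⊗[k] (H ⊗[k] H))) *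
        TensorProduct.assoc k H H (H ⊗[k] H)
          (TensorProduct.map comul.toLinearMap LinearMap.id (phi : H ⊗[k] (H ⊗[k] H))) =
      ((1 : H) ⊗ₜ[k] (phi : H ⊗[k] (H ⊗[k] H))) *
        TensorProduct.map LinearMap.id (TensorProduct.assoc k H H H).toLinearMap
          (TensorProduct.map LinearMap.id (TensorProduct.map comul.toLinearMap LinearMap.id)
            (phi : H ⊗[k] (H ⊗[k] H))) *
        TensorProduct.map LinearMap.id (TensorProduct.assoc k H H H).toLinearMap
          (TensorProduct.assoc k H (H ⊗[k] H) H
            ((phi : H ⊗[k] (H ⊗[k] H)) ⊗ₜ[k] (1 : H)))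
  /-- `(I ⊗ ε ⊗ I)(φ) = 1 ⊗ 1` -/
  phi_counit :
    TensorProduct.map LinearMap.id
        ((TensorProduct.lid k H).toLinearMap ∘ₗ
          TensorProduct.map counit.toLinearMap LinearMap.id)
        (phi : H ⊗[k] (H ⊗[k] H)) = (1 : H ⊗[k] H)

/-- A quasi-Hopf algebra `(H, Δ, ε, φ, S, α, β)`: a quasi-bialgebra with a unital anti-algebra
homomorphism `S` and elements `α, β`. Bijectivity of `S` is not part of the definition. -/
class QuasiHopfAlgebra (k : Type u) (H : Type v) [Field k] [Ring H] [Algebra k H]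
    extends QuasiBialgebra k H where
  /-- the antipode `S` -/
  antipode : H →ₗ[k] H
  alpha : H
  beta : H
  antipode_one : antipode 1 = 1
  antipode_mul : ∀ g h : H, antipode (g * h) = antipode h * antipode g
  /-- `S(h₁) α h₂ = ε(h) α` -/
  antipode_alpha : ∀ h : H,
    LinearMap.mul' k H
        (TensorProduct.map (LinearMap.mulRight k alpha ∘ₗ antipode) LinearMap.id (comul h)) =
      counit h • alpha
  /-- `h₁ β S(h₂) = ε(h) β` -/
  antipode_beta : ∀ h : H,
    LinearMap.mul' k H
        (TensorProduct.map LinearMap.id (LinearMap.mulLeft k beta ∘ₗ antipode) (comul h)) =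
      counit h • beta
  /-- `X¹ β S(X²) α X³ = 1` -/
  phi_beta_alpha :
    LinearMap.mul' k H
        (TensorProduct.map (LinearMap.mulRight k beta)
          (LinearMap.mul' k H ∘ₗ
            TensorProduct.map (LinearMap.mulRight k alpha ∘ₗ antipode) LinearMap.id)
          (phi : H ⊗[k] (H ⊗[k] H))) = 1
  /-- `S(x¹) α x² β S(x³) = 1` -/
  phi_inv_alpha_beta :
    LinearMap.mul' k H
        (TensorProduct.map (LinearMap.mulRight k alpha ∘ₗ antipode)
          (LinearMap.mul' k H ∘ₗ
            TensorProduct.map LinearMap.id (LinearMap.mulLeft k beta ∘ₗ antipode))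
          ((phi⁻¹ : (H ⊗[k] (H ⊗[k] H))ˣ) : H ⊗[k] (H ⊗[k] H))) = 1

section ModuleAlgebra

variable (k : Type u) (H : Type v) {A : Type w} [Field k] [Ring H] [Algebra k H]
  [NonAssocRing A] [Module k A] [Module H A] [IsScalarTower k H A]

/-- For `a : A`, the linear map `H → A`, `h ↦ h · a`. -/
def orbit (a : A) : H →ₗ[k] A := (Algebra.lsmul k k A : H →ₐ[k] Module.End k A).toLinearMap.flip a

variable (A) in
/-- The left `H`-module `A`, with its `k`-bilinear unital multiplication (not assumed associative),
is a left `H`-module algebra. -/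
class IsModuleAlgebra [IsScalarTower k A A] [SMulCommClass k A A] [QuasiBialgebra k H] :
    Prop where
  /-- `(ab)c = (X¹·a)[(X²·b)(X³·c)]` -/
  mul_assoc' : ∀ a b c : A,
    (a * b) * c =
      LinearMap.mul' k A
        (TensorProduct.map (orbit k H a)
          (LinearMap.mul' k A ∘ₗ TensorProduct.map (orbit k H b) (orbit k H c))
          (QuasiBialgebra.phi (k := k) (H := H) : H ⊗[k] (H ⊗[k] H)))
  /-- `h·(ab) = (h₁·a)(h₂·b)` -/
  smul_mul' : ∀ (h : H) (a b : A),
    h • (a * b) =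
      LinearMap.mul' k A
        (TensorProduct.map (orbit k H a) (orbit k H b) (QuasiBialgebra.comul (k := k) h))
  /-- `h·1 = ε(h)1` -/
  smul_one' : ∀ h : H, h • (1 : A) = QuasiBialgebra.counit (k := k) h • (1 : A)

variable (A) in
/-- The space of invariants `B = A^H = {a | h·a = ε(h)a for all h}`. -/
def invariants [QuasiBialgebra k H] : Submodule k A where
  carrier := {a | ∀ h : H, h • a = QuasiBialgebra.counit (k := k) h • a}
  zero_mem' := fun h => by rw [smul_zero, smul_zero]
  add_mem' := fun {a b} ha hb h => by
    have ha' : h • a = QuasiBialgebra.counit (k := k) h • a := ha h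
    have hb' : h • b = QuasiBialgebra.counit (k := k) h • b := hb h
    rw [smul_add, smul_add, ha', hb']
  smul_mem' := fun c a ha h => by
    have ha' : h • a = QuasiBialgebra.counit (k := k) h • a := ha h
    rw [smul_comm h c a, ha', smul_comm]

end ModuleAlgebra

section Elements

variable (k : Type u) {H : Type v} [Field k] [Ring H] [Algebra k H]

/-- `t` is a left integral in `H`: `ht = ε(h)t` for all `h`. -/
def IsLeftIntegral [QuasiBialgebra k H] (t : H) : Prop :=
  ∀ h : H, h * t = QuasiBialgebra.counit (k := k) h • t

open Classical in
/-- The modular element `γ` determined by a nonzero left integral `t`: the algebra morphism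
`γ : H → k` with `th = γ(h)t` for all `h`, regarded as a linear form. For finite dimensional
quasi-Hopf `H` it exists, because the left integrals form a one dimensional ideal; it is unique
since `t ≠ 0`. -/
def modular (t : H) : H →ₗ[k] k :=
  if hex : ∃ γ : H →ₐ[k] k, ∀ h : H, t * h = γ h • t then hex.choose.toLinearMap else 0

variable (H) in
/-- The inverse `S⁻¹` of the antipode for composition in `End_k(H)`; the antipode of a finite
dimensional quasi-Hopf algebra is always bijective. -/
def antipodeInv [QuasiHopfAlgebra k H] : H →ₗ[k] H :=
  Ring.inverse (QuasiHopfAlgebra.antipode (k := k) (H := H) : Module.End k H)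

variable (H) in
/-- `p_L = X² S⁻¹(X¹ β) ⊗ X³`. -/
def pL [QuasiHopfAlgebra k H] : H ⊗[k] H :=
  TensorProduct.map
    (LinearMap.mul' k H ∘ₗ (TensorProduct.comm k H H).toLinearMap ∘ₗ
      TensorProduct.map
        (antipodeInv k H ∘ₗ LinearMap.mulRight k (QuasiHopfAlgebra.beta k : H)) LinearMap.id)
    LinearMap.id
    ((TensorProduct.assoc k H H H).symm
      (QuasiBialgebra.phi (k := k) (H := H) : H ⊗[k] (H ⊗[k] H)))

variable (H) in
/-- `q_L = S(x¹) α x² ⊗ x³`. -/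
def qL [QuasiHopfAlgebra k H] : H ⊗[k] H :=
  TensorProduct.map
    (LinearMap.mul' k H ∘ₗ
      TensorProduct.map
        (LinearMap.mulRight k (QuasiHopfAlgebra.alpha k : H) ∘ₗ
          QuasiHopfAlgebra.antipode (k := k)) LinearMap.id)
    LinearMap.id
    ((TensorProduct.assoc k H H H).symm
      (((QuasiBialgebra.phi (k := k) (H := H))⁻¹ : (H ⊗[k] (H ⊗[k] H))ˣ) :
        H ⊗[k] (H ⊗[k] H)))

/-- The linear map `g ⊗ h ↦ γ(h) g`. -/
def evalRight (γ : H →ₗ[k] k) : H ⊗[k] H →ₗ[k] H :=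
  (TensorProduct.rid k H).toLinearMap ∘ₗ TensorProduct.map LinearMap.id γ

/-- The linear map `h ↦ γ ⇀ h = γ(h₂) h₁`. -/
def hit [QuasiBialgebra k H] (γ : H →ₗ[k] k) : H →ₗ[k] H :=
  evalRight k γ ∘ₗ (QuasiBialgebra.comul (k := k) (H := H)).toLinearMap

/-- `Λ = γ(q_L²) q_L¹`. -/
def Lam [QuasiHopfAlgebra k H] (γ : H →ₗ[k] k) : H := evalRight k γ (qL k H)

end Elements

section Morita

variable (k : Type u) (H : Type v) {A : Type w} [Field k] [Ring H] [Algebra k H]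
  [QuasiHopfAlgebra k H]
  [NonAssocRing A] [Module k A] [IsScalarTower k A A] [SMulCommClass k A A]
  [Module H A] [IsScalarTower k H A]

variable (A) in
/-- The linear map `A ⊗ A → A`, `a ⊗ b ↦ (p_L¹·a)(p_L²·b)`. -/
def pMul : A ⊗[k] A →ₗ[k] A :=
  LinearMap.mul' k A ∘ₗ
    TensorProduct.homTensorHomMap (RingHom.id k) A A A A
      (TensorProduct.map (Algebra.lsmul k k A : H →ₐ[k] Module.End k A).toLinearMap
        (Algebra.lsmul k k A : H →ₐ[k] Module.End k A).toLinearMap (pL k H))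

variable {H}

/-- The left action of `A#H` on `A`: `(a#h)b = a(h·b)`. -/
def smashLeft (a : A) (h : H) (b : A) : A := a * (h • b)

/-- The right action of `A#H` on `A`:
`a ·_γ (b#h) = S⁻¹(S(X²) Λ (γ ⇀ X³h)) · [(p_L¹ S⁻¹(X¹)·a)(p_L²·b)]`. -/
def smashRight (γ : H →ₗ[k] k) (a b : A) (h : H) : A :=
  TensorProduct.lift
    ((Algebra.lsmul k k A : H →ₐ[k] Module.End k A).toLinearMap.flip.compl₁₂
      -- `X¹ ↦ (p_L¹ S⁻¹(X¹)·a)(p_L²·b)`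
      (((TensorProduct.curry (pMul k H A)).flip b) ∘ₗ orbit k H a ∘ₗ antipodeInv k H)
      -- `X² ⊗ X³ ↦ S⁻¹(S(X²) Λ (γ ⇀ X³h))`
      (antipodeInv k H ∘ₗ LinearMap.mul' k H ∘ₗ
        TensorProduct.map
          (LinearMap.mulRight k (Lam k γ) ∘ₗ QuasiHopfAlgebra.antipode (k := k))
          (hit k γ ∘ₗ LinearMap.mulRight k h)))
    (QuasiBialgebra.phi (k := k) (H := H) : H ⊗[k] (H ⊗[k] H))

variable (A) in
/-- The relations `(a ·_γ x) ⊗ c = a ⊗ xc` for `x` in `A#H`. Both sides are additive in `x` and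
`A#H` is spanned by the elements `b#h`, so it is enough to impose them for `x = b#h`. -/
def smashRelations (t : H) : Submodule k (A ⊗[k] A) :=
  Submodule.span k
    {z | ∃ (a b c : A) (h : H),
      z = smashRight k (modular k t) a b h ⊗ₜ[k] c - a ⊗ₜ[k] smashLeft b h c}

variable (A) in
/-- The tensor product `A ⊗_{A#H} A` over the smash product. -/
abbrev SmashTensor (t : H) : Type _ := (A ⊗[k] A) ⧸ smashRelations k A t

/-- The class of `a ⊗ b` in `A ⊗_{A#H} A`. -/
def smashTmul (t : H) (a b : A) : SmashTensor k A t :=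
  (smashRelations k A t).mkQ (a ⊗ₜ[k] b)

variable (A) in
/-- `m` is the Morita map `(-,-) : A ⊗_{A#H} A → B = A^H`, `(a,b) = t·[(p_L¹·a)(p_L²·b)]`. There is
at most one such `m`, since the classes of the `a ⊗ b` span `A ⊗_{A#H} A`. -/
def IsMoritaMap (t : H) (m : SmashTensor k A t →ₗ[k] invariants k H A) : Prop :=
  ∀ a b : A, (m (smashTmul k t a b) : A) = t • pMul k H A (a ⊗ₜ[k] b)

variable (H A) in
/-- `Φ` is a total integral for `A`: it is left `H`-linear for `(h ⇀ h*)(g) = h*(gh)` on `H*`, and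
`Φ(ε) = 1`. -/
def IsTotalIntegral (Φ : Module.Dual k H →ₗ[k] A) : Prop :=
  (∀ (h : H) (f : Module.Dual k H), Φ (f ∘ₗ LinearMap.mulRight k h) = h • Φ f) ∧
    Φ (QuasiBialgebra.counit (k := k) (H := H)).toLinearMap = 1

end Morita

end QuasiHopf

end

open QuasiHopf

/-! Everything passes through statement 3. If $t\cdot a=1$ and $b\in B$, then $h\cdot(ab)=(h\cdot
a)b$, so $t\cdot(ab)=b$. Since $(\varepsilon\otimes I)(p_L)=\varepsilon(\beta)1$ with
$\varepsilon(\beta)\neq0$, the pair $(1,\varepsilon(\beta)^{-1}ab)$ goes to $b$. Conversely, a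
preimage of $1$ exhibits $1$ as $t\cdot(\text{something})$.

For total integrals, a functional with $f(t)=1$ satisfies $t\rightharpoonup f=\varepsilon$, so
$\Phi(f)$ has trace one. In the other direction, $f\mapsto f(S^{-1}(w^1))w^2$ with $w=q_L\Delta(t)$
is a left $H$-linear map $H^*\to H$ sending $\varepsilon$ to $\varepsilon(\alpha)t$; acting on $a$
and dividing by $\varepsilon(\alpha)\neq0$ gives $\Phi$ (`IsLeftIntegral.dualContract_mulRight`,
`dualContract_counit`).

The harder point is that the Morita map respects the relations of $A\otimes_{A\#H}A$
(`smul_pMul_smashRight`). With $t h=\gamma(h)t$, the identities for $p_L$ and $q_L$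
(`pLTwist_comul`, `pLTwist_qL`) move $\gamma\rightharpoonup h$ and $\Lambda$ from one argument to
the other, and the pentagon in the form `assocElt_mul_twist₃` does the rest.

Two facts about $H$ itself are proved from the existence of $t\neq0$: $S$ is bijective
(`antipode_bijective`), and left integrals are unique up to a scalar
(`IsLeftIntegral.exists_eq_smul`), which yields $\gamma$. The computations rest on one device: a
rearranged pentagon is contracted with $S$, $\alpha$, $\beta$, and the factors containing $\Delta$
next to $\alpha$ or $\beta$ disappear by the antipode axioms. -/

noncomputable section

set_option linter.unusedSectionVars false
set_option linter.unusedSimpArgs false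

namespace QuasiHopf

open QuasiBialgebra QuasiHopfAlgebra TensorProduct

section Instances

variable (k : Type*) (H : Type*) [Field k] [Ring H] [Algebra k H]

/-- Shortcut instance: the search for it is too long otherwise. -/
instance instSemiringTensorFour : Semiring (H ⊗[k] (H ⊗[k] (H ⊗[k] H))) :=
  Algebra.TensorProduct.instSemiring

/-- Shortcut instance: the search for it is too long otherwise. -/
instance instMulZeroClassTensorFour : MulZeroClass (H ⊗[k] (H ⊗[k] (H ⊗[k] H))) :=
  (instSemiringTensorFour k H).toNonUnitalSemiring.toNonUnitalNonAssocSemiring.toMulZeroClass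

end Instances

/-! ### The pentagon, its rearrangements, and the counit on $\phi$ -/

section Associator

variable (k : Type*) (H : Type*) [Field k] [Ring H] [Algebra k H] [QuasiBialgebra k H]

/-- `Δ ⊗ I ⊗ I`. -/
def comul₁ : H ⊗[k] (H ⊗[k] H) →ₐ[k] H ⊗[k] (H ⊗[k] (H ⊗[k] H)) :=
  (Algebra.TensorProduct.assoc k k k H H (H ⊗[k] H)).toAlgHom.comp
    (Algebra.TensorProduct.map comul (AlgHom.id k (H ⊗[k] H)))

/-- `I ⊗ Δ ⊗ I`. -/
def comul₂ : H ⊗[k] (H ⊗[k] H) →ₐ[k] H ⊗[k] (H ⊗[k] (H ⊗[k] H)) :=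
  Algebra.TensorProduct.map (AlgHom.id k H)
    ((Algebra.TensorProduct.assoc k k k H H H).toAlgHom.comp
      (Algebra.TensorProduct.map comul (AlgHom.id k H)))

/-- `I ⊗ I ⊗ Δ`. -/
def comul₃ : H ⊗[k] (H ⊗[k] H) →ₐ[k] H ⊗[k] (H ⊗[k] (H ⊗[k] H)) :=
  Algebra.TensorProduct.map (AlgHom.id k H) (Algebra.TensorProduct.map (AlgHom.id k H) comul)

/-- `w ↦ 1 ⊗ w`. -/
def oneTmul : H ⊗[k] (H ⊗[k] H) →ₐ[k] H ⊗[k] (H ⊗[k] (H ⊗[k] H)) :=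
  Algebra.TensorProduct.includeRight

/-- `w ↦ w ⊗ 1`. -/
def tmulOne : H ⊗[k] (H ⊗[k] H) →ₐ[k] H ⊗[k] (H ⊗[k] (H ⊗[k] H)) :=
  Algebra.TensorProduct.map (AlgHom.id k H)
    (Algebra.TensorProduct.map (AlgHom.id k H) Algebra.TensorProduct.includeLeft)

/-- `ε ⊗ I ⊗ I`. -/
def counit₁ : H ⊗[k] (H ⊗[k] H) →ₐ[k] H ⊗[k] H :=
  (Algebra.TensorProduct.lid k (H ⊗[k] H)).toAlgHom.comp
    (Algebra.TensorProduct.map counit (AlgHom.id k (H ⊗[k] H)))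

/-- `I ⊗ ε ⊗ I`. -/
def counit₂ : H ⊗[k] (H ⊗[k] H) →ₐ[k] H ⊗[k] H :=
  Algebra.TensorProduct.map (AlgHom.id k H)
    ((Algebra.TensorProduct.lid k H).toAlgHom.comp
      (Algebra.TensorProduct.map counit (AlgHom.id k H)))

/-- `I ⊗ I ⊗ ε`. -/
def counit₃ : H ⊗[k] (H ⊗[k] H) →ₐ[k] H ⊗[k] H :=
  Algebra.TensorProduct.map (AlgHom.id k H)
    ((Algebra.TensorProduct.rid k k H).toAlgHom.comp
      (Algebra.TensorProduct.map (AlgHom.id k H) counit))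

/-- The associator. -/
abbrev assocElt : H ⊗[k] (H ⊗[k] H) := (phi (k := k) (H := H) : H ⊗[k] (H ⊗[k] H))

/-- The inverse of the associator. -/
abbrev assocInv : H ⊗[k] (H ⊗[k] H) :=
  ((phi (k := k) (H := H))⁻¹ : (H ⊗[k] (H ⊗[k] H))ˣ)

variable {H}

@[simp] lemma comul₁_tmul (a b c : H) :
    comul₁ k H (a ⊗ₜ (b ⊗ₜ c)) = TensorProduct.assoc k H H (H ⊗[k] H) (comul a ⊗ₜ (b ⊗ₜ c)) := rfl

@[simp] lemma comul₂_tmul (a b c : H) :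
    comul₂ k H (a ⊗ₜ (b ⊗ₜ c)) = a ⊗ₜ TensorProduct.assoc k H H H (comul b ⊗ₜ c) := rfl

@[simp] lemma comul₃_tmul (a b c : H) :
    comul₃ k H (a ⊗ₜ (b ⊗ₜ c)) = a ⊗ₜ (b ⊗ₜ comul c) := rfl

@[simp] lemma oneTmul_apply (w : H ⊗[k] (H ⊗[k] H)) : oneTmul k H w = 1 ⊗ₜ w := rfl

@[simp] lemma tmulOne_tmul (a b c : H) :
    tmulOne k H (a ⊗ₜ (b ⊗ₜ c)) = a ⊗ₜ (b ⊗ₜ (c ⊗ₜ 1)) := rfl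

@[simp] lemma counit₁_tmul (a b c : H) :
    counit₁ k H (a ⊗ₜ (b ⊗ₜ c)) = counit (k := k) a • (b ⊗ₜ c) := rfl

@[simp] lemma counit₂_tmul (a b c : H) :
    counit₂ k H (a ⊗ₜ (b ⊗ₜ c)) = a ⊗ₜ (counit (k := k) b • c) := rfl

@[simp] lemma counit₃_tmul (a b c : H) :
    counit₃ k H (a ⊗ₜ (b ⊗ₜ c)) = a ⊗ₜ (counit (k := k) c • b) := rfl

variable (H)

lemma assocElt_mul_assocInv : assocElt k H * assocInv k H = 1 := Units.mul_inv _

lemma assocInv_mul_assocElt : assocInv k H * assocElt k H = 1 := Units.inv_mul _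

lemma pentagon' :
    comul₃ k H (assocElt k H) * comul₁ k H (assocElt k H) =
      oneTmul k H (assocElt k H) * comul₂ k H (assocElt k H) * tmulOne k H (assocElt k H) := by
  have h := pentagon (k := k) (H := H)
  have h1 : ∀ w : H ⊗[k] (H ⊗[k] H), comul₁ k H w =
      TensorProduct.assoc k H H (H ⊗[k] H)
        (TensorProduct.map comul.toLinearMap LinearMap.id w) := fun w => rfl
  have h2 : ∀ w : H ⊗[k] (H ⊗[k] H), comul₂ k H w =
      TensorProduct.map LinearMap.id (TensorProduct.assoc k H H H).toLinearMap
          (TensorProduct.map LinearMap.id (TensorProduct.map comul.toLinearMap LinearMap.id)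
            w) := by
    intro w
    rw [← LinearMap.comp_apply, ← TensorProduct.map_comp]
    rfl
  have h3 : ∀ w : H ⊗[k] (H ⊗[k] H), tmulOne k H w =
      TensorProduct.map LinearMap.id (TensorProduct.assoc k H H H).toLinearMap
          (TensorProduct.assoc k H (H ⊗[k] H) H (w ⊗ₜ[k] (1 : H))) := by
    intro w
    induction w with
    | zero => simp
    | add x y hx hy => simp only [map_add, add_tmul, hx, hy]
    | tmul a w =>
      induction w with
      | zero => simp
      | add x y hx hy => simp only [tmul_add, map_add, add_tmul, hx, hy]
      | tmul b c => simp
  rw [h1, h2, h3]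
  exact h

/-- An algebra homomorphism sends `φ` and `φ⁻¹` to inverse elements. -/
lemma map_assocElt_mul_map_assocInv {R : Type*} [Semiring R] [Algebra k R]
    (f : H ⊗[k] (H ⊗[k] H) →ₐ[k] R) : f (assocElt k H) * f (assocInv k H) = 1 := by
  rw [← map_mul, assocElt_mul_assocInv, map_one]

lemma map_assocInv_mul_map_assocElt {R : Type*} [Semiring R] [Algebra k R]
    (f : H ⊗[k] (H ⊗[k] H) →ₐ[k] R) : f (assocInv k H) * f (assocElt k H) = 1 := by
  rw [← map_mul, assocInv_mul_assocElt, map_one]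

/-- The image of the associator under an algebra homomorphism, as a unit. -/
def mapPhi {R : Type*} [Semiring R] [Algebra k R] (f : H ⊗[k] (H ⊗[k] H) →ₐ[k] R) : Rˣ :=
  ⟨f (assocElt k H), f (assocInv k H), map_assocElt_mul_map_assocInv k H f,
    map_assocInv_mul_map_assocElt k H f⟩

lemma pentagon_units :
    mapPhi k H (comul₃ k H) * mapPhi k H (comul₁ k H) =
      mapPhi k H (oneTmul k H) * mapPhi k H (comul₂ k H) * mapPhi k H (tmulOne k H) :=
  Units.ext (pentagon' k H)

/-- This and the next two rearrangements of the pentagon put factors $\Delta$ where a contraction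
with $\alpha$, $\beta$ absorbs them, leaving a single $\phi^{\pm1}$ to which a normalisation axiom
applies. -/
lemma tmulOne_mul_comul₁_inv :
    tmulOne k H (assocElt k H) * comul₁ k H (assocInv k H) =
      comul₂ k H (assocInv k H) *
        (oneTmul k H (assocInv k H) * comul₃ k H (assocElt k H)) := by
  have h : mapPhi k H (tmulOne k H) * (mapPhi k H (comul₁ k H))⁻¹ =
      (mapPhi k H (comul₂ k H))⁻¹ *
        ((mapPhi k H (oneTmul k H))⁻¹ * mapPhi k H (comul₃ k H)) := by
    rw [mul_inv_eq_iff_eq_mul, mul_assoc, mul_assoc, pentagon_units]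
    group
  exact congrArg Units.val h

lemma comul₃_inv_mul_oneTmul :
    comul₃ k H (assocInv k H) * oneTmul k H (assocElt k H) =
      comul₁ k H (assocElt k H) *
        (tmulOne k H (assocInv k H) * comul₂ k H (assocInv k H)) := by
  have h : (mapPhi k H (comul₃ k H))⁻¹ * mapPhi k H (oneTmul k H) =
      mapPhi k H (comul₁ k H) *
        ((mapPhi k H (tmulOne k H))⁻¹ * (mapPhi k H (comul₂ k H))⁻¹) := by
    rw [inv_mul_eq_iff_eq_mul, ← mul_assoc (mapPhi k H (comul₃ k H)), pentagon_units]
    group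
  exact congrArg Units.val h

lemma oneTmul_inv_mul_comul₃ :
    oneTmul k H (assocInv k H) * comul₃ k H (assocElt k H) =
      comul₂ k H (assocElt k H) *
        (tmulOne k H (assocElt k H) * comul₁ k H (assocInv k H)) := by
  have h : (mapPhi k H (oneTmul k H))⁻¹ * mapPhi k H (comul₃ k H) =
      mapPhi k H (comul₂ k H) *
        (mapPhi k H (tmulOne k H) * (mapPhi k H (comul₁ k H))⁻¹) := by
    rw [inv_mul_eq_iff_eq_mul, ← mul_assoc, ← mul_assoc, eq_mul_inv_iff_mul_eq, pentagon_units]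
  exact congrArg Units.val h

lemma counit₂_assocElt : counit₂ k H (assocElt k H) = 1 := phi_counit

/-- The algebra map that kills the second tensor factor of `H ⊗ H ⊗ H ⊗ H` by `ε`. -/
def counit₂₄ : H ⊗[k] (H ⊗[k] (H ⊗[k] H)) →ₐ[k] H ⊗[k] (H ⊗[k] H) :=
  Algebra.TensorProduct.map (AlgHom.id k H)
    ((Algebra.TensorProduct.lid k (H ⊗[k] H)).toAlgHom.comp
      (Algebra.TensorProduct.map counit (AlgHom.id k (H ⊗[k] H))))

/-- The algebra map that kills the third tensor factor of `H ⊗ H ⊗ H ⊗ H` by `ε`. -/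
def counit₃₄ : H ⊗[k] (H ⊗[k] (H ⊗[k] H)) →ₐ[k] H ⊗[k] (H ⊗[k] H) :=
  Algebra.TensorProduct.map (AlgHom.id k H) (counit₂ k H)

variable {H} in
@[simp] lemma counit₂₄_tmul (a b c d : H) :
    counit₂₄ k H (a ⊗ₜ (b ⊗ₜ (c ⊗ₜ d))) = a ⊗ₜ (counit (k := k) b • (c ⊗ₜ d)) := rfl

variable {H} in
@[simp] lemma counit₃₄_tmul (a b c d : H) :
    counit₃₄ k H (a ⊗ₜ (b ⊗ₜ (c ⊗ₜ d))) = a ⊗ₜ (b ⊗ₜ (counit (k := k) c • d)) := rfl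

/-- Linear maps on `H ⊗ H ⊗ H` agree if they agree on pure tensors. -/
lemma ext_tmul₃ {M : Type*} [AddCommMonoid M] [Module k M]
    {f g : H ⊗[k] (H ⊗[k] H) →ₗ[k] M}
    (h : ∀ a b c : H, f (a ⊗ₜ (b ⊗ₜ c)) = g (a ⊗ₜ (b ⊗ₜ c))) (w : H ⊗[k] (H ⊗[k] H)) :
    f w = g w := by
  have : f = g := by
    ext a b c
    exact h a b c
  rw [this]

/-- Applying $\varepsilon$ to the second leg of the pentagon leaves
$\phi=(1\otimes(\varepsilon\otimes I\otimes I)(\phi))\,\phi$, and $\phi$ cancels. -/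
lemma counit₁_assocElt : counit₁ k H (assocElt k H) = 1 := by
  have hp := congrArg (counit₂₄ k H) (pentagon' k H)
  have e3 : counit₂₄ k H (comul₃ k H (assocElt k H)) =
      Algebra.TensorProduct.map (AlgHom.id k H) comul (counit₂ k H (assocElt k H)) := by
    refine ext_tmul₃ k H (f := (counit₂₄ k H).toLinearMap ∘ₗ (comul₃ k H).toLinearMap)
      (g := (Algebra.TensorProduct.map (AlgHom.id k H) comul).toLinearMap ∘ₗ
        (counit₂ k H).toLinearMap) (fun a b c => ?_) _
    simp [counit₂₄]
  have e1 : counit₂₄ k H (comul₁ k H (assocElt k H)) = assocElt k H := by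
    refine ext_tmul₃ k H (f := (counit₂₄ k H).toLinearMap ∘ₗ (comul₁ k H).toLinearMap)
      (g := LinearMap.id) (fun a b c => ?_) _
    have : ∀ w : H ⊗[k] H, counit₂₄ k H (TensorProduct.assoc k H H (H ⊗[k] H) (w ⊗ₜ (b ⊗ₜ c))) =
        TensorProduct.rid k H (TensorProduct.map LinearMap.id counit.toLinearMap w) ⊗ₜ
          (b ⊗ₜ c) := by
      intro w
      induction w with
      | zero => simp
      | add x y hx hy => simp only [map_add, add_tmul, hx, hy]
      | tmul x y => simp [smul_tmul]
    simp [this, counit_right]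
  have e2 : counit₂₄ k H (comul₂ k H (assocElt k H)) = assocElt k H := by
    refine ext_tmul₃ k H (f := (counit₂₄ k H).toLinearMap ∘ₗ (comul₂ k H).toLinearMap)
      (g := LinearMap.id) (fun a b c => ?_) _
    have : ∀ w : H ⊗[k] H, counit₂₄ k H (a ⊗ₜ (TensorProduct.assoc k H H H (w ⊗ₜ c))) =
        a ⊗ₜ (TensorProduct.lid k H (TensorProduct.map counit.toLinearMap LinearMap.id w) ⊗ₜ
          c) := by
      intro w
      induction w with
      | zero => simp
      | add x y hx hy => simp only [map_add, add_tmul, tmul_add, hx, hy]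
      | tmul x y => simp [smul_tmul']
    simp [this, counit_left]
  have eo : counit₂₄ k H (oneTmul k H (assocElt k H)) = 1 ⊗ₜ counit₁ k H (assocElt k H) := rfl
  have et : counit₂₄ k H (tmulOne k H (assocElt k H)) =
      Algebra.TensorProduct.map (AlgHom.id k H) Algebra.TensorProduct.includeLeft
        (counit₂ k H (assocElt k H)) := by
    refine ext_tmul₃ k H (f := (counit₂₄ k H).toLinearMap ∘ₗ (tmulOne k H).toLinearMap)
      (g := (Algebra.TensorProduct.map (AlgHom.id k H)
          Algebra.TensorProduct.includeLeft).toLinearMap ∘ₗ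
        (counit₂ k H).toLinearMap) (fun a b c => ?_) _
    change a ⊗ₜ (counit (k := k) b • (c ⊗ₜ[k] 1)) = a ⊗ₜ ((counit (k := k) b • c) ⊗ₜ[k] 1)
    rw [smul_tmul']
  rw [map_mul, map_mul, map_mul, e3, e1, e2, eo, et, counit₂_assocElt, map_one, map_one, one_mul,
    mul_one] at hp
  have h1 : (1 : H) ⊗ₜ[k] counit₁ k H (assocElt k H) = 1 := by
    have := congrArg (· * assocInv k H) hp
    simp only [mul_assoc, assocElt_mul_assocInv, mul_one] at this
    exact this.symm
  have h2 := congrArg (counit₁ k H) h1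
  have h3 : ∀ w : H ⊗[k] H, counit₁ k H (1 ⊗ₜ w) = w := fun w => by
    change counit (k := k) (1 : H) • w = w
    rw [map_one, one_smul]
  rwa [h3, map_one] at h2

/-- The mirror argument: $\varepsilon$ on the third leg of the pentagon leaves
$\phi=\phi\,((I\otimes I\otimes\varepsilon)(\phi)\otimes1)$. -/
lemma counit₃_assocElt : counit₃ k H (assocElt k H) = 1 := by
  have hp := congrArg (counit₃₄ k H) (pentagon' k H)
  have e3 : counit₃₄ k H (comul₃ k H (assocElt k H)) = assocElt k H := by
    refine ext_tmul₃ k H (f := (counit₃₄ k H).toLinearMap ∘ₗ (comul₃ k H).toLinearMap)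
      (g := LinearMap.id) (fun a b c => ?_) _
    have : ∀ w : H ⊗[k] H, counit₃₄ k H (a ⊗ₜ (b ⊗ₜ w)) =
        a ⊗ₜ (b ⊗ₜ TensorProduct.lid k H (TensorProduct.map counit.toLinearMap LinearMap.id w)) :=
      fun w => rfl
    simp [this, counit_left]
  have e1 : counit₃₄ k H (comul₁ k H (assocElt k H)) =
      (Algebra.TensorProduct.assoc k k k H H H)
        (Algebra.TensorProduct.map comul (AlgHom.id k H) (counit₂ k H (assocElt k H))) := by
    refine ext_tmul₃ k H (f := (counit₃₄ k H).toLinearMap ∘ₗ (comul₁ k H).toLinearMap)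
      (g := (Algebra.TensorProduct.assoc k k k H H H).toLinearMap ∘ₗ
        (Algebra.TensorProduct.map comul (AlgHom.id k H)).toLinearMap ∘ₗ
        (counit₂ k H).toLinearMap) (fun a b c => ?_) _
    have : ∀ w : H ⊗[k] H, counit₃₄ k H (TensorProduct.assoc k H H (H ⊗[k] H) (w ⊗ₜ (b ⊗ₜ c))) =
        TensorProduct.assoc k H H H (w ⊗ₜ (counit (k := k) b • c)) := by
      intro w
      induction w with
      | zero => simp
      | add x y hx hy => simp only [map_add, add_tmul, hx, hy]
      | tmul x y => simp
    exact this _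
  have e2 : counit₃₄ k H (comul₂ k H (assocElt k H)) = assocElt k H := by
    refine ext_tmul₃ k H (f := (counit₃₄ k H).toLinearMap ∘ₗ (comul₂ k H).toLinearMap)
      (g := LinearMap.id) (fun a b c => ?_) _
    have : ∀ w : H ⊗[k] H, counit₃₄ k H (a ⊗ₜ (TensorProduct.assoc k H H H (w ⊗ₜ c))) =
        a ⊗ₜ (TensorProduct.rid k H (TensorProduct.map LinearMap.id counit.toLinearMap w) ⊗ₜ
          c) := by
      intro w
      induction w with
      | zero => simp
      | add x y hx hy => simp only [map_add, add_tmul, tmul_add, hx, hy]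
      | tmul x y => simp [smul_tmul]
    simp [this, counit_right]
  have eo : counit₃₄ k H (oneTmul k H (assocElt k H)) = 1 ⊗ₜ counit₂ k H (assocElt k H) := rfl
  have et : counit₃₄ k H (tmulOne k H (assocElt k H)) =
      Algebra.TensorProduct.map (AlgHom.id k H) Algebra.TensorProduct.includeLeft
        (counit₃ k H (assocElt k H)) := by
    refine ext_tmul₃ k H (f := (counit₃₄ k H).toLinearMap ∘ₗ (tmulOne k H).toLinearMap)
      (g := (Algebra.TensorProduct.map (AlgHom.id k H)
          Algebra.TensorProduct.includeLeft).toLinearMap ∘ₗ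
        (counit₃ k H).toLinearMap) (fun a b c => ?_) _
    simp
  rw [map_mul, map_mul, map_mul, e3, e1, e2, eo, et, counit₂_assocElt, map_one, map_one,
    mul_one, ← Algebra.TensorProduct.one_def, one_mul] at hp
  have h1 : Algebra.TensorProduct.map (AlgHom.id k H)
      (Algebra.TensorProduct.includeLeft : H →ₐ[k] H ⊗[k] H)
        (counit₃ k H (assocElt k H)) = 1 := by
    have := congrArg (assocInv k H * ·) hp
    simp only [← mul_assoc, assocInv_mul_assocElt, one_mul] at this
    exact this.symm
  have h2 := congrArg (counit₃ k H) h1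
  have h3 : ∀ w : H ⊗[k] H, counit₃ k H (Algebra.TensorProduct.map (AlgHom.id k H)
      (Algebra.TensorProduct.includeLeft : H →ₐ[k] H ⊗[k] H) w) = w := fun w => by
    induction w with
    | zero => simp
    | add x y hx hy => simp only [map_add, hx, hy]
    | tmul x y => simp
  rwa [h3, map_one] at h2

lemma map_assocInv_eq_one {R : Type*} [Semiring R] [Algebra k R]
    {f : H ⊗[k] (H ⊗[k] H) →ₐ[k] R} (hf : f (assocElt k H) = 1) : f (assocInv k H) = 1 := by
  have := map_assocElt_mul_map_assocInv k H f
  rwa [hf, one_mul] at this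

end Associator

/-! ### Contractions of the pentagon with $S$, $\alpha$, $\beta$ -/

section Contractions

variable (k : Type*) (H : Type*) [Field k] [Ring H] [Algebra k H] [QuasiHopfAlgebra k H]

local notation "𝒮" => QuasiHopfAlgebra.antipode (k := k)

/-- `a ⊗ b ↦ S(a) α b`. -/
def evalMap : H ⊗[k] H →ₗ[k] H :=
  LinearMap.mul' k H ∘ₗ
    TensorProduct.map (LinearMap.mulRight k (alpha k) ∘ₗ 𝒮) LinearMap.id

/-- `a ⊗ b ↦ a β S(b)`. -/
def coevalMap : H ⊗[k] H →ₗ[k] H :=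
  LinearMap.mul' k H ∘ₗ
    TensorProduct.map LinearMap.id (LinearMap.mulLeft k (beta k) ∘ₗ 𝒮)

/-- `a ⊗ b ⊗ c ↦ a β S(b) α c`. -/
def zigzagβ : H ⊗[k] (H ⊗[k] H) →ₗ[k] H :=
  LinearMap.mul' k H ∘ₗ TensorProduct.map (LinearMap.mulRight k (beta k)) (evalMap k H)

/-- `a ⊗ b ⊗ c ↦ S(a) α b β S(c)`. -/
def zigzagα : H ⊗[k] (H ⊗[k] H) →ₗ[k] H :=
  LinearMap.mul' k H ∘ₗ
    TensorProduct.map (LinearMap.mulRight k (alpha k) ∘ₗ 𝒮) (coevalMap k H)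

/-- `a ⊗ (b ⊗ (c ⊗ d)) ↦ (a ⊗ (b ⊗ c)) ⊗ d`. -/
def splitLast : H ⊗[k] (H ⊗[k] (H ⊗[k] H)) →ₗ[k] (H ⊗[k] (H ⊗[k] H)) ⊗[k] H :=
  (TensorProduct.assoc k H (H ⊗[k] H) H).symm.toLinearMap ∘ₗ
    TensorProduct.map LinearMap.id (TensorProduct.assoc k H H H).symm.toLinearMap

/-- `a ⊗ b ⊗ c ⊗ d ↦ a ⊗ S(b) α c β S(d)`. -/
def zigzagα₂ : H ⊗[k] (H ⊗[k] (H ⊗[k] H)) →ₗ[k] H ⊗[k] H :=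
  TensorProduct.map LinearMap.id (zigzagα k H)

/-- `a ⊗ b ⊗ c ⊗ d ↦ S(a) α b β S(c) ⊗ d`. -/
def zigzagα₁ : H ⊗[k] (H ⊗[k] (H ⊗[k] H)) →ₗ[k] H ⊗[k] H :=
  TensorProduct.map (zigzagα k H) LinearMap.id ∘ₗ splitLast k H

/-- `a ⊗ b ⊗ c ⊗ d ↦ a β S(b) α c ⊗ d`. -/
def zigzagβ₁ : H ⊗[k] (H ⊗[k] (H ⊗[k] H)) →ₗ[k] H ⊗[k] H :=
  TensorProduct.map (zigzagβ k H) LinearMap.id ∘ₗ splitLast k H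

variable {H}

@[simp] lemma evalMap_tmul (a b : H) : evalMap k H (a ⊗ₜ b) = 𝒮 a * alpha k * b := rfl

@[simp] lemma coevalMap_tmul (a b : H) :
    coevalMap k H (a ⊗ₜ b) = a * (beta k * 𝒮 b) := rfl

@[simp] lemma zigzagα_tmul (a b c : H) : zigzagα k H (a ⊗ₜ (b ⊗ₜ c)) =
    𝒮 a * alpha k * (b * (beta k * 𝒮 c)) := rfl

@[simp] lemma zigzagβ_tmul (a b c : H) : zigzagβ k H (a ⊗ₜ (b ⊗ₜ c)) =
    a * beta k * (𝒮 b * alpha k * c) := rfl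

@[simp] lemma zigzagα₂_tmul (a b c d : H) : zigzagα₂ k H (a ⊗ₜ (b ⊗ₜ (c ⊗ₜ d))) =
    a ⊗ₜ (𝒮 b * alpha k * (c * (beta k * 𝒮 d))) := rfl

@[simp] lemma zigzagα₁_tmul (a b c d : H) : zigzagα₁ k H (a ⊗ₜ (b ⊗ₜ (c ⊗ₜ d))) =
    (𝒮 a * alpha k * (b * (beta k * 𝒮 c))) ⊗ₜ d := rfl

@[simp] lemma zigzagβ₁_tmul (a b c d : H) : zigzagβ₁ k H (a ⊗ₜ (b ⊗ₜ (c ⊗ₜ d))) =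
    (a * beta k * (𝒮 b * alpha k * c)) ⊗ₜ d := rfl

lemma evalMap_comul (h : H) : evalMap k H (comul (k := k) h) = counit (k := k) h • alpha k :=
  antipode_alpha h

lemma coevalMap_comul (h : H) : coevalMap k H (comul (k := k) h) = counit (k := k) h • beta k :=
  antipode_beta h

variable (H)

lemma zigzagβ_assocElt : zigzagβ k H (assocElt k H) = 1 := phi_beta_alpha

lemma zigzagα_assocInv : zigzagα k H (assocInv k H) = 1 := phi_inv_alpha_beta

/-- Bilinear expressions `f (w * z)` agree if they agree on pure tensors. -/
lemma ext_mul₃₄ {M : Type*} [AddCommMonoid M] [Module k M]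
    {f g : H ⊗[k] (H ⊗[k] H) →ₗ[k] H ⊗[k] (H ⊗[k] (H ⊗[k] H)) →ₗ[k] M}
    (h : ∀ a b c x y z u : H,
      f (a ⊗ₜ (b ⊗ₜ c)) (x ⊗ₜ (y ⊗ₜ (z ⊗ₜ u))) = g (a ⊗ₜ (b ⊗ₜ c)) (x ⊗ₜ (y ⊗ₜ (z ⊗ₜ u))))
    (w : H ⊗[k] (H ⊗[k] H)) (v : H ⊗[k] (H ⊗[k] (H ⊗[k] H))) : f w v = g w v := by
  have : f = g := by
    ext a b c x y z u
    exact h a b c x y z u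
  rw [this]

/-- `a ⊗ b ↦ 1 ⊗ 1 ⊗ a ⊗ b`. -/
def unit₁ : H ⊗[k] H →ₐ[k] H ⊗[k] (H ⊗[k] (H ⊗[k] H)) :=
  (oneTmul k H).comp Algebra.TensorProduct.includeRight

/-- `a ⊗ b ↦ a ⊗ 1 ⊗ 1 ⊗ b`. -/
def unit₂ : H ⊗[k] H →ₐ[k] H ⊗[k] (H ⊗[k] (H ⊗[k] H)) :=
  Algebra.TensorProduct.map (AlgHom.id k H)
    (Algebra.TensorProduct.includeRight.comp Algebra.TensorProduct.includeRight)

/-- `a ⊗ b ↦ a ⊗ b ⊗ 1 ⊗ 1`. -/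
def unit₃ : H ⊗[k] H →ₐ[k] H ⊗[k] (H ⊗[k] (H ⊗[k] H)) :=
  Algebra.TensorProduct.map (AlgHom.id k H) Algebra.TensorProduct.includeLeft

variable {H} in
@[simp] lemma unit₁_tmul (a b : H) : unit₁ k H (a ⊗ₜ b) = 1 ⊗ₜ (1 ⊗ₜ (a ⊗ₜ b)) := rfl

variable {H} in
@[simp] lemma unit₂_tmul (a b : H) : unit₂ k H (a ⊗ₜ b) = a ⊗ₜ (1 ⊗ₜ (1 ⊗ₜ b)) := rfl

variable {H} in
@[simp] lemma unit₃_tmul (a b : H) : unit₃ k H (a ⊗ₜ b) = a ⊗ₜ (b ⊗ₜ (1 ⊗ₜ 1)) := rfl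

/-- `F (D w * z) = F (U (c w) * z)` follows from its case of pure tensors. -/
lemma absorb_left {M : Type*} [AddCommGroup M] [Module k M]
    (F : H ⊗[k] (H ⊗[k] (H ⊗[k] H)) →ₗ[k] M)
    (D : H ⊗[k] (H ⊗[k] H) →ₐ[k] H ⊗[k] (H ⊗[k] (H ⊗[k] H)))
    (c : H ⊗[k] (H ⊗[k] H) →ₐ[k] H ⊗[k] H)
    (U : H ⊗[k] H →ₐ[k] H ⊗[k] (H ⊗[k] (H ⊗[k] H)))
    (h : ∀ p q r x y z u : H,
      F (D (p ⊗ₜ (q ⊗ₜ r)) * (x ⊗ₜ (y ⊗ₜ (z ⊗ₜ u)))) =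
        F (U (c (p ⊗ₜ (q ⊗ₜ r))) * (x ⊗ₜ (y ⊗ₜ (z ⊗ₜ u)))))
    (w : H ⊗[k] (H ⊗[k] H)) (hw : c w = 1) (v : H ⊗[k] (H ⊗[k] (H ⊗[k] H))) :
    F (D w * v) = F v := by
  have := ext_mul₃₄ k H
    (f := (LinearMap.mul k (H ⊗[k] (H ⊗[k] (H ⊗[k] H)))).compr₂ F ∘ₗ D.toLinearMap)
    (g := (LinearMap.mul k (H ⊗[k] (H ⊗[k] (H ⊗[k] H)))).compr₂ F ∘ₗ (U.comp c).toLinearMap) (fun p q r x y z u => by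
      simpa using h p q r x y z u) w v
  simpa [hw] using this

/-- `F (z * D w) = F (z * U (c w))` follows from its case of pure tensors. -/
lemma absorb_right {M : Type*} [AddCommGroup M] [Module k M]
    (F : H ⊗[k] (H ⊗[k] (H ⊗[k] H)) →ₗ[k] M)
    (D : H ⊗[k] (H ⊗[k] H) →ₐ[k] H ⊗[k] (H ⊗[k] (H ⊗[k] H)))
    (c : H ⊗[k] (H ⊗[k] H) →ₐ[k] H ⊗[k] H)
    (U : H ⊗[k] H →ₐ[k] H ⊗[k] (H ⊗[k] (H ⊗[k] H)))
    (h : ∀ p q r x y z u : H,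
      F ((x ⊗ₜ (y ⊗ₜ (z ⊗ₜ u))) * D (p ⊗ₜ (q ⊗ₜ r))) =
        F ((x ⊗ₜ (y ⊗ₜ (z ⊗ₜ u))) * U (c (p ⊗ₜ (q ⊗ₜ r)))))
    (w : H ⊗[k] (H ⊗[k] H)) (hw : c w = 1) (v : H ⊗[k] (H ⊗[k] (H ⊗[k] H))) :
    F (v * D w) = F v := by
  have := ext_mul₃₄ k H
    (f := (LinearMap.mul k (H ⊗[k] (H ⊗[k] (H ⊗[k] H)))).flip.compr₂ F ∘ₗ D.toLinearMap)
    (g := (LinearMap.mul k (H ⊗[k] (H ⊗[k] (H ⊗[k] H)))).flip.compr₂ F ∘ₗ (U.comp c).toLinearMap) (fun p q r x y z u => by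
      simpa using h p q r x y z u) w v
  simpa [hw] using this

/-- Since $S$ reverses products, a factor $\Delta(q)$ multiplied on the left becomes adjacent to
$\alpha$ as $S(q_1)\alpha q_2=\varepsilon(q)\alpha$. In this and the following absorption lemmas,
left factors vanish against $\alpha$ in this way, and right factors against $\beta$ through
$q_1\beta S(q_2)=\varepsilon(q)\beta$. -/
lemma zigzagα₂_comul₂_mul (w : H ⊗[k] (H ⊗[k] H)) (hw : counit₂ k H w = 1)
    (v : H ⊗[k] (H ⊗[k] (H ⊗[k] H))) :
    zigzagα₂ k H (comul₂ k H w * v) = zigzagα₂ k H v := by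
  refine absorb_left k H _ _ (counit₂ k H) (unit₂ k H) (fun p q r x y z u => ?_) w hw v
  have : ∀ m : H ⊗[k] H, zigzagα₂ k H
      ((p ⊗ₜ (TensorProduct.assoc k H H H (m ⊗ₜ r))) * (x ⊗ₜ (y ⊗ₜ (z ⊗ₜ u)))) =
      (p * x) ⊗ₜ (𝒮 y * evalMap k H m * (z * (beta k * 𝒮 (r * u)))) := by
    intro m
    induction m with
    | zero => simp
    | add m n hm hn => simp only [map_add, add_tmul, tmul_add, add_mul, mul_add, hm, hn]
    | tmul m n => simp [antipode_mul, mul_assoc]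
  rw [comul₂_tmul, this, evalMap_comul]
  simp [antipode_mul, mul_assoc, smul_mul_assoc, mul_smul_comm, smul_tmul]

lemma zigzagα₂_mul_comul₃ (w : H ⊗[k] (H ⊗[k] H)) (hw : counit₃ k H w = 1)
    (v : H ⊗[k] (H ⊗[k] (H ⊗[k] H))) :
    zigzagα₂ k H (v * comul₃ k H w) = zigzagα₂ k H v := by
  refine absorb_right k H _ _ (counit₃ k H) (unit₃ k H) (fun p q r x y z u => ?_) w hw v
  have : ∀ m : H ⊗[k] H, zigzagα₂ k H
      ((x ⊗ₜ (y ⊗ₜ (z ⊗ₜ u))) * (p ⊗ₜ (q ⊗ₜ m))) =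
      (x * p) ⊗ₜ (𝒮 (y * q) * alpha k * (z * (coevalMap k H m * 𝒮 u))) := by
    intro m
    induction m with
    | zero => simp
    | add m n hm hn => simp only [map_add, add_tmul, tmul_add, add_mul, mul_add, hm, hn]
    | tmul m n => simp [antipode_mul, mul_assoc]
  rw [comul₃_tmul, this, coevalMap_comul]
  simp [antipode_mul, mul_assoc, smul_mul_assoc, mul_smul_comm, smul_tmul]

lemma zigzagα₁_comul₁_mul (w : H ⊗[k] (H ⊗[k] H)) (hw : counit₁ k H w = 1)
    (v : H ⊗[k] (H ⊗[k] (H ⊗[k] H))) :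
    zigzagα₁ k H (comul₁ k H w * v) = zigzagα₁ k H v := by
  refine absorb_left k H _ _ (counit₁ k H) (unit₁ k H) (fun p q r x y z u => ?_) w hw v
  have : ∀ m : H ⊗[k] H, zigzagα₁ k H
      ((TensorProduct.assoc k H H (H ⊗[k] H) (m ⊗ₜ (q ⊗ₜ r))) * (x ⊗ₜ (y ⊗ₜ (z ⊗ₜ u)))) =
      (𝒮 x * evalMap k H m * (y * (beta k * 𝒮 (q * z)))) ⊗ₜ (r * u) := by
    intro m
    induction m with
    | zero => simp
    | add m n hm hn => simp only [map_add, add_tmul, tmul_add, add_mul, mul_add, hm, hn]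
    | tmul m n => simp [antipode_mul, mul_assoc]
  rw [comul₁_tmul, this, evalMap_comul]
  simp [antipode_mul, mul_assoc, smul_mul_assoc, mul_smul_comm, smul_tmul]

lemma zigzagα₁_mul_comul₂ (w : H ⊗[k] (H ⊗[k] H)) (hw : counit₂ k H w = 1)
    (v : H ⊗[k] (H ⊗[k] (H ⊗[k] H))) :
    zigzagα₁ k H (v * comul₂ k H w) = zigzagα₁ k H v := by
  refine absorb_right k H _ _ (counit₂ k H) (unit₂ k H) (fun p q r x y z u => ?_) w hw v
  have : ∀ m : H ⊗[k] H, zigzagα₁ k H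
      ((x ⊗ₜ (y ⊗ₜ (z ⊗ₜ u))) * (p ⊗ₜ (TensorProduct.assoc k H H H (m ⊗ₜ r)))) =
      (𝒮 (x * p) * alpha k * (y * (coevalMap k H m * 𝒮 z))) ⊗ₜ (u * r) := by
    intro m
    induction m with
    | zero => simp
    | add m n hm hn => simp only [map_add, add_tmul, tmul_add, add_mul, mul_add, hm, hn]
    | tmul m n => simp [antipode_mul, mul_assoc]
  rw [comul₂_tmul, this, coevalMap_comul]
  simp [antipode_mul, mul_assoc, smul_mul_assoc, mul_smul_comm, smul_tmul]

lemma zigzagβ₁_comul₂_mul (w : H ⊗[k] (H ⊗[k] H)) (hw : counit₂ k H w = 1)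
    (v : H ⊗[k] (H ⊗[k] (H ⊗[k] H))) :
    zigzagβ₁ k H (comul₂ k H w * v) = zigzagβ₁ k H v := by
  refine absorb_left k H _ _ (counit₂ k H) (unit₂ k H) (fun p q r x y z u => ?_) w hw v
  have : ∀ m : H ⊗[k] H, zigzagβ₁ k H
      ((p ⊗ₜ (TensorProduct.assoc k H H H (m ⊗ₜ r))) * (x ⊗ₜ (y ⊗ₜ (z ⊗ₜ u)))) =
      (p * x * beta k * (𝒮 y * evalMap k H m * z)) ⊗ₜ (r * u) := by
    intro m
    induction m with
    | zero => simp
    | add m n hm hn => simp only [map_add, add_tmul, tmul_add, add_mul, mul_add, hm, hn]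
    | tmul m n => simp [antipode_mul, mul_assoc]
  rw [comul₂_tmul, this, evalMap_comul]
  simp [antipode_mul, mul_assoc, smul_mul_assoc, mul_smul_comm, smul_tmul]

lemma zigzagβ₁_mul_comul₁ (w : H ⊗[k] (H ⊗[k] H)) (hw : counit₁ k H w = 1)
    (v : H ⊗[k] (H ⊗[k] (H ⊗[k] H))) :
    zigzagβ₁ k H (v * comul₁ k H w) = zigzagβ₁ k H v := by
  refine absorb_right k H _ _ (counit₁ k H) (unit₁ k H) (fun p q r x y z u => ?_) w hw v
  have : ∀ m : H ⊗[k] H, zigzagβ₁ k H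
      ((x ⊗ₜ (y ⊗ₜ (z ⊗ₜ u))) * (TensorProduct.assoc k H H (H ⊗[k] H) (m ⊗ₜ (q ⊗ₜ r)))) =
      (x * coevalMap k H m * (𝒮 y * alpha k * (z * q))) ⊗ₜ (u * r) := by
    intro m
    induction m with
    | zero => simp
    | add m n hm hn => simp only [map_add, add_tmul, tmul_add, add_mul, mul_add, hm, hn]
    | tmul m n => simp [antipode_mul, mul_assoc]
  rw [comul₁_tmul, this, coevalMap_comul]
  simp [antipode_mul, mul_assoc, smul_mul_assoc, mul_smul_comm, smul_tmul]

/-- `X¹y¹₁ ⊗ S(X²y¹₂) α X³y² β S(y³) = 1 ⊗ 1`. -/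
lemma zigzagα₂_tmulOne_mul_comul₁ :
    zigzagα₂ k H (tmulOne k H (assocElt k H) * comul₁ k H (assocInv k H)) = 1 := by
  rw [tmulOne_mul_comul₁_inv,
    zigzagα₂_comul₂_mul k H _ (map_assocInv_eq_one k H (counit₂_assocElt k H)),
    zigzagα₂_mul_comul₃ k H _ (counit₃_assocElt k H)]
  change (1 : H) ⊗ₜ zigzagα k H (assocInv k H) = 1
  rw [zigzagα_assocInv, Algebra.TensorProduct.one_def]

/-- `S(x¹) α x² Y¹ β S(x³₁ Y²) ⊗ x³₂ Y³ = 1 ⊗ 1`. -/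
lemma zigzagα₁_comul₃_mul_oneTmul :
    zigzagα₁ k H (comul₃ k H (assocInv k H) * oneTmul k H (assocElt k H)) = 1 := by
  rw [comul₃_inv_mul_oneTmul, zigzagα₁_comul₁_mul k H _ (counit₁_assocElt k H),
    zigzagα₁_mul_comul₂ k H _ (map_assocInv_eq_one k H (counit₂_assocElt k H))]
  have : ∀ w, zigzagα₁ k H (tmulOne k H w) = zigzagα k H w ⊗ₜ 1 :=
    ext_tmul₃ k H (f := zigzagα₁ k H ∘ₗ (tmulOne k H).toLinearMap)
      (g := (TensorProduct.mk k H H).flip 1 ∘ₗ zigzagα k H) (fun a b c => rfl)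
  rw [this, zigzagα_assocInv, Algebra.TensorProduct.one_def]

/-- `X¹ β S(y¹X²) α y²X³₁ ⊗ y³X³₂ = 1 ⊗ 1`. -/
lemma zigzagβ₁_oneTmul_mul_comul₃ :
    zigzagβ₁ k H (oneTmul k H (assocInv k H) * comul₃ k H (assocElt k H)) = 1 := by
  rw [oneTmul_inv_mul_comul₃, zigzagβ₁_comul₂_mul k H _ (counit₂_assocElt k H),
    zigzagβ₁_mul_comul₁ k H _ (map_assocInv_eq_one k H (counit₁_assocElt k H))]
  have : ∀ w, zigzagβ₁ k H (tmulOne k H w) = zigzagβ k H w ⊗ₜ 1 :=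
    ext_tmul₃ k H (f := zigzagβ₁ k H ∘ₗ (tmulOne k H).toLinearMap)
      (g := (TensorProduct.mk k H H).flip 1 ∘ₗ zigzagβ k H) (fun a b c => rfl)
  rw [this, zigzagβ_assocElt, Algebra.TensorProduct.one_def]

end Contractions

lemma exists_dual_eq_one (k : Type*) {V : Type*} [Field k] [AddCommGroup V] [Module k V] {v : V}
    (hv : v ≠ 0) : ∃ f : Module.Dual k V, f v = 1 := by
  obtain ⟨f, hf⟩ : ∃ f : Module.Dual k V, f v ≠ 0 := by
    by_contra! h
    exact hv ((Module.forall_dual_apply_eq_zero_iff k v).mp h)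
  exact ⟨(f v)⁻¹ • f, by simp [hf]⟩

/-! ### Bijectivity of the antipode from a nonzero left integral -/

section AntipodeBijective

variable (k : Type*) (H : Type*) [Field k] [Ring H] [Algebra k H] [QuasiHopfAlgebra k H]

local notation "𝒮" => QuasiHopfAlgebra.antipode (k := k)

/-- `a ⊗ b ⊗ c ↦ S(a) α b ⊗ c`. -/
def evalMap₁ : H ⊗[k] (H ⊗[k] H) →ₗ[k] H ⊗[k] H :=
  TensorProduct.map (evalMap k H) LinearMap.id ∘ₗ (TensorProduct.assoc k H H H).symm.toLinearMap

/-- `a ⊗ b ⊗ c ↦ a ⊗ S(b) α c`. -/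
def evalMap₂ : H ⊗[k] (H ⊗[k] H) →ₗ[k] H ⊗[k] H :=
  TensorProduct.map LinearMap.id (evalMap k H)

variable {H}

@[simp] lemma evalMap₁_tmul (a b c : H) :
    evalMap₁ k H (a ⊗ₜ (b ⊗ₜ c)) = (𝒮 a * alpha k * b) ⊗ₜ c := rfl

@[simp] lemma evalMap₂_tmul (a b c : H) :
    evalMap₂ k H (a ⊗ₜ (b ⊗ₜ c)) = a ⊗ₜ (𝒮 b * alpha k * c) := rfl

variable (H) in
lemma qL_eq : qL k H = evalMap₁ k H (assocInv k H) := rfl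

/-- `(Δ ⊗ I)Δ(h)`, rebracketed. -/
abbrev comulLeft (h : H) : H ⊗[k] (H ⊗[k] H) :=
  TensorProduct.assoc k H H H (TensorProduct.map comul.toLinearMap LinearMap.id (comul h))

/-- `(I ⊗ Δ)Δ(h)`. -/
abbrev comulRight (h : H) : H ⊗[k] (H ⊗[k] H) :=
  TensorProduct.map LinearMap.id comul.toLinearMap (comul h)

lemma assocElt_mul_comulLeft (h : H) :
    assocElt k H * comulLeft k h = comulRight k h * assocElt k H := by
  have := congrArg (· * assocElt k H) (coassoc (k := k) h)
  simpa only [mul_assoc, assocInv_mul_assocElt, mul_one] using this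

lemma assocInv_mul_comulRight (h : H) :
    assocInv k H * comulRight k h = comulLeft k h * assocInv k H := by
  have := congrArg (assocInv k H * ·) (coassoc (k := k) h)
  simp only [← mul_assoc, assocInv_mul_assocElt, one_mul] at this
  exact this.symm

lemma comulRight_eq (h : H) :
    comulRight k h = assocElt k H * comulLeft k h * assocInv k H := (coassoc h).symm

lemma evalMap₁_mul_tmul (z : H ⊗[k] (H ⊗[k] H)) (h : H) (m : H ⊗[k] H) :
    evalMap₁ k H (z * (h ⊗ₜ m)) = (𝒮 h ⊗ₜ 1) * evalMap₁ k H z * m := by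
  refine ext_tmul₃ k H (f := evalMap₁ k H ∘ₗ LinearMap.mulRight k (h ⊗ₜ m))
    (g := LinearMap.mulRight k m ∘ₗ LinearMap.mulLeft k (𝒮 h ⊗ₜ 1) ∘ₗ evalMap₁ k H)
    (fun a b c => ?_) z
  induction m with
  | zero => simp
  | add m n hm hn =>
    simp only [LinearMap.comp_apply, LinearMap.mulRight_apply] at hm hn ⊢
    simp only [tmul_add, mul_add, map_add, hm, hn]
  | tmul m n => simp [antipode_mul, mul_assoc]

lemma evalMap₁_assoc_mul (z : H ⊗[k] (H ⊗[k] H)) (h g : H) :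
    evalMap₁ k H (TensorProduct.assoc k H H H (comul g ⊗ₜ h) * z) =
      (1 ⊗ₜ (counit (k := k) g • h)) * evalMap₁ k H z := by
  refine ext_tmul₃ k H
    (f := evalMap₁ k H ∘ₗ LinearMap.mulLeft k (TensorProduct.assoc k H H H (comul g ⊗ₜ h)))
    (g := LinearMap.mulLeft k (1 ⊗ₜ (counit (k := k) g • h)) ∘ₗ evalMap₁ k H)
    (fun a b c => ?_) z
  have : ∀ m : H ⊗[k] H,
      evalMap₁ k H (TensorProduct.assoc k H H H (m ⊗ₜ h) * (a ⊗ₜ (b ⊗ₜ c))) =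
        (𝒮 a * evalMap k H m * b) ⊗ₜ (h * c) := by
    intro m
    induction m with
    | zero => simp
    | add m n hm hn => simp only [map_add, add_tmul, add_mul, mul_add, hm, hn]
    | tmul m n => simp [antipode_mul, mul_assoc]
  simp [this, evalMap_comul, mul_assoc, smul_tmul]

/-- `h₁ ⊗ h₂ ↦ (S(h₁) ⊗ 1) q_L Δ(h₂)`. -/
def qLTwist : H ⊗[k] H →ₗ[k] H ⊗[k] H :=
  TensorProduct.lift
    ((LinearMap.mul k (H ⊗[k] H)).compl₁₂
      (LinearMap.mulRight k (qL k H) ∘ₗ (TensorProduct.mk k H H).flip 1 ∘ₗ 𝒮)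
      (comul (k := k) (H := H)).toLinearMap)

@[simp] lemma qLTwist_tmul (a b : H) :
    qLTwist k (a ⊗ₜ b) = (𝒮 a ⊗ₜ 1) * qL k H * comul b := rfl

/-- `(1 ⊗ h) q_L = (S(h₁) ⊗ 1) q_L Δ(h₂)`. -/
lemma one_tmul_mul_qL (h : H) : (1 ⊗ₜ h) * qL k H = qLTwist k (comul h) := by
  -- Contract the first two legs of $\phi^{-1}(I\otimes\Delta)\Delta(h)=(\Delta\otimes
  -- I)\Delta(h)\phi^{-1}$; on the right, $\Delta(h_1)$ meets $\alpha$ and collapses.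
  have e := congrArg (evalMap₁ k H) (assocInv_mul_comulRight k h)
  have hr : ∀ w : H ⊗[k] H, evalMap₁ k H
      (assocInv k H * TensorProduct.map LinearMap.id comul.toLinearMap w) = qLTwist k w := by
    intro w
    induction w with
    | zero => simp
    | add v w hv hw => simp only [map_add, mul_add, hv, hw]
    | tmul a b =>
      rw [TensorProduct.map_tmul, evalMap₁_mul_tmul]
      rfl
  have hl : ∀ w : H ⊗[k] H, evalMap₁ k H
      (TensorProduct.assoc k H H H (TensorProduct.map comul.toLinearMap LinearMap.id w) *
        assocInv k H) =
      (1 ⊗ₜ TensorProduct.lid k H (TensorProduct.map counit.toLinearMap LinearMap.id w)) *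
        qL k H := by
    intro w
    induction w with
    | zero => simp
    | add v w hv hw => simp only [map_add, add_mul, tmul_add, hv, hw]
    | tmul a b =>
      rw [TensorProduct.map_tmul]
      exact evalMap₁_assoc_mul k _ _ _
  rw [hr, hl, counit_left] at e
  exact e.symm

variable {k}

lemma IsLeftIntegral.comul_mul {t : H} (ht : IsLeftIntegral k t) (h : H) :
    comul (k := k) h * comul t = counit (k := k) h • comul t := by
  rw [← map_mul, ht h, map_smul]

/-- `(1 ⊗ h) q_L Δ(t) = (S(h) ⊗ 1) q_L Δ(t)` for a left integral `t`. -/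
lemma IsLeftIntegral.one_tmul_mul {t : H} (ht : IsLeftIntegral k t) (h : H) :
    (1 ⊗ₜ h) * (qL k H * comul t) = (𝒮 h ⊗ₜ 1) * (qL k H * comul t) := by
  -- In $(S(h_1)\otimes1)q_L\Delta(h_2)\Delta(t)$ the last two factors give
  -- $\varepsilon(h_2)\Delta(t)$.
  have : ∀ w : H ⊗[k] H, qLTwist k w * comul t =
      (𝒮 (TensorProduct.rid k H (TensorProduct.map LinearMap.id counit.toLinearMap w)) ⊗ₜ 1) *
        (qL k H * comul t) := by
    intro w
    induction w with
    | zero => simp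
    | add v w hv hw => simp only [map_add, add_mul, add_tmul, hv, hw]
    | tmul a b =>
      rw [qLTwist_tmul, mul_assoc, ht.comul_mul, mul_smul_comm, mul_assoc]
      simp [← smul_tmul', smul_mul_assoc]
  rw [← mul_assoc, one_tmul_mul_qL, this, counit_right]

lemma zigzagβ₁_oneTmul_mul (z : H ⊗[k] (H ⊗[k] H)) (a b : H) (m : H ⊗[k] H) :
    zigzagβ₁ k H (oneTmul k H z * (a ⊗ₜ (b ⊗ₜ m))) =
      ((a * beta k * 𝒮 b) ⊗ₜ 1) * (evalMap₁ k H z * m) := by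
  refine ext_tmul₃ k H
    (f := zigzagβ₁ k H ∘ₗ LinearMap.mulRight k (a ⊗ₜ (b ⊗ₜ m)) ∘ₗ (oneTmul k H).toLinearMap)
    (g := LinearMap.mulLeft k ((a * beta k * 𝒮 b) ⊗ₜ 1) ∘ₗ LinearMap.mulRight k m ∘ₗ
      evalMap₁ k H)
    (fun x y z => ?_) z
  induction m with
  | zero => simp
  | add m n hm hn =>
    simp only [LinearMap.comp_apply, LinearMap.mulRight_apply, LinearMap.mulLeft_apply]
      at hm hn ⊢
    simp only [tmul_add, mul_add, map_add, hm, hn]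
  | tmul m n => simp [antipode_mul, mul_assoc]

/-- `Δ(t) = (β ⊗ 1) q_L Δ(t)` for a left integral `t`. -/
lemma IsLeftIntegral.comul_eq {t : H} (ht : IsLeftIntegral k t) :
    comul (k := k) t = (beta k ⊗ₜ 1) * (qL k H * comul t) := by
  let G : H ⊗[k] H →ₗ[k] H ⊗[k] H :=
    LinearMap.mulRight k (qL k H * comul t) ∘ₗ (TensorProduct.mk k H H).flip 1 ∘ₗ coevalMap k H
  -- Multiply `zigzagβ₁_oneTmul_mul_comul₃` on the right by $\Delta(t)$: the integral turns
  -- $\Delta(X^3)$ into $\varepsilon(X^3)$, and $(I\otimes I\otimes\varepsilon)(\phi)=1\otimes 1$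
  -- removes the rest of $\phi$.
  have key := ext_tmul₃ k H
    (f := LinearMap.mulRight k (comul t) ∘ₗ zigzagβ₁ k H ∘ₗ
      LinearMap.mulLeft k (oneTmul k H (assocInv k H)) ∘ₗ (comul₃ k H).toLinearMap)
    (g := G ∘ₗ (counit₃ k H).toLinearMap) (fun a b c => by
      have e := zigzagβ₁_oneTmul_mul (k := k) (assocInv k H) a b (comul c)
      change zigzagβ₁ k H (oneTmul k H (assocInv k H) * (a ⊗ₜ (b ⊗ₜ comul c))) * comul t =
        G (a ⊗ₜ (counit (k := k) c • b))
      rw [e, ← qL_eq, mul_assoc (_ ⊗ₜ _), mul_assoc (qL k H), ht.comul_mul]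
      simp [G, smul_mul_assoc, mul_smul_comm, mul_assoc, ← smul_tmul']) (assocElt k H)
  have h1 : zigzagβ₁ k H (oneTmul k H (assocInv k H) * comul₃ k H (assocElt k H)) * comul t =
      G (counit₃ k H (assocElt k H)) := key
  rw [zigzagβ₁_oneTmul_mul_comul₃, counit₃_assocElt, one_mul, Algebra.TensorProduct.one_def] at h1
  simpa [G, map_one, antipode_one, mul_assoc] using h1

lemma IsLeftIntegral.one_tmul_mul_comul_eq_zero {t : H} (ht : IsLeftIntegral k t) {n : H}
    (hn : 𝒮 n = 0) : (1 ⊗ₜ n) * comul (k := k) t = 0 := by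
  rw [ht.comul_eq, ← mul_assoc,
    show (1 : H) ⊗ₜ[k] n * beta k ⊗ₜ[k] 1 = beta k ⊗ₜ[k] 1 * 1 ⊗ₜ[k] n by simp,
    mul_assoc, ht.one_tmul_mul, hn]
  simp

/-- The element $t_1\otimes nS((t_2)_1)\alpha(t_2)_2$ equals $t\otimes n\alpha$ by the antipode
axiom. After reassociating it vanishes, because $\ker S$ is an ideal annihilating the second leg of
$\Delta(t)$ from the left. -/
lemma mul_alpha_eq_zero [FiniteDimensional k H] {t : H} (ht : IsLeftIntegral k t) (ht0 : t ≠ 0)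
    {n : H} (hn : 𝒮 n = 0) : n * alpha k = 0 := by
  obtain ⟨c, hc⟩ := TensorProduct.eq_repr_basis_left (Module.finBasis k H) (comul (k := k) t)
  set e := Module.finBasis k H
  have hkill : ∀ n : H, 𝒮 n = 0 → ∀ i, n * c i = 0 := by
    intro n hn i
    have h0 := ht.one_tmul_mul_comul_eq_zero hn
    rw [← hc, Finsupp.sum, Finset.mul_sum] at h0
    simp only [Algebra.TensorProduct.tmul_mul_tmul, one_mul] at h0
    have h1 := TensorProduct.sum_tmul_basis_left_eq_zero e
      (c.mapRange (n * ·) (mul_zero n)) (by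
        rw [Finsupp.sum_mapRange_index (by simp)]
        exact h0)
    simpa using DFunLike.congr_fun h1 i
  let G : H ⊗[k] (H ⊗[k] H) →ₗ[k] H ⊗[k] H :=
    TensorProduct.map LinearMap.id (LinearMap.mulLeft k n) ∘ₗ evalMap₂ k H
  have hG : ∀ w : H ⊗[k] H, G (TensorProduct.map LinearMap.id comul.toLinearMap w) =
      TensorProduct.rid k H (TensorProduct.map LinearMap.id counit.toLinearMap w) ⊗ₜ
        (n * alpha k) := by
    intro w
    induction w with
    | zero => simp
    | add v w hv hw => simp only [map_add, add_tmul, hv, hw]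
    | tmul a b =>
      have : G (a ⊗ₜ comul b) = a ⊗ₜ (n * evalMap k H (comul b)) := rfl
      rw [TensorProduct.map_tmul]
      simp [this, evalMap_comul, smul_tmul]
  have hzero : ∀ (i) (m : H ⊗[k] H) (y z : H ⊗[k] (H ⊗[k] H)),
      G (y * TensorProduct.assoc k H H H (m ⊗ₜ c i) * z) = 0 := by
    intro i m y z
    refine ext_tmul₃ k H (f := G ∘ₗ LinearMap.mulLeft k
      (y * TensorProduct.assoc k H H H (m ⊗ₜ c i))) (g := 0) (fun z₁ z₂ z₃ => ?_) z
    refine ext_tmul₃ k H (f := G ∘ₗ LinearMap.mulRight k (z₁ ⊗ₜ (z₂ ⊗ₜ z₃)) ∘ₗ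
      LinearMap.mulRight k (TensorProduct.assoc k H H H (m ⊗ₜ c i))) (g := 0)
      (fun y₁ y₂ y₃ => ?_) y
    induction m with
    | zero => simp
    | add m n hm hn =>
      simp only [LinearMap.comp_apply, LinearMap.mulRight_apply, LinearMap.zero_apply]
        at hm hn ⊢
      simp only [add_tmul, map_add, mul_add, add_mul, hm, hn, add_zero]
    | tmul a b =>
      -- A right multiple of $n$ still lies in $\ker S$, so it kills $c_i$.
      have h1 : n * (𝒮 (y₂ * b * z₂) * alpha k * y₃) * c i = 0 :=
        hkill _ (by rw [antipode_mul, hn, mul_zero]) i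
      have h2 : n * (𝒮 (y₂ * b * z₂) * alpha k * (y₃ * c i * z₃)) = 0 := by
        simp only [← mul_assoc] at h1 ⊢
        rw [h1, zero_mul]
      simp [G, h2]
  have h := hG (comul t)
  rw [counit_right] at h
  have h' : G (comulRight k t) = 0 := by
    rw [comulRight_eq, comulLeft]
    nth_rewrite 1 [← hc]
    rw [Finsupp.sum, map_sum, map_sum, Finset.mul_sum, Finset.sum_mul, map_sum]
    exact Finset.sum_eq_zero fun i _ => hzero i _ _ _
  rw [h'] at h
  obtain ⟨f, hf⟩ := exists_dual_eq_one k ht0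
  have := congrArg (fun w => TensorProduct.lid k H (TensorProduct.map f LinearMap.id w)) h
  simpa [hf] using this.symm

/-- If $S(n)=0$, expand $n=nX^1\beta S(X^2)\alpha X^3$: the part before $\alpha$ is in $\ker S$,
hence is annihilated by right multiplication by $\alpha$. -/
lemma antipode_injective [FiniteDimensional k H] {t : H} (ht : IsLeftIntegral k t)
    (ht0 : t ≠ 0) : Function.Injective (𝒮 : H →ₗ[k] H) := by
  rw [injective_iff_map_eq_zero]
  intro n hn
  have h := ext_tmul₃ k H (f := LinearMap.mulLeft k n ∘ₗ zigzagβ k H) (g := 0) (fun a b c => by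
    have h1 : n * (a * beta k * 𝒮 b) * alpha k = 0 :=
      mul_alpha_eq_zero ht ht0 (by rw [antipode_mul, hn, mul_zero])
    have h2 : n * (a * beta k * (𝒮 b * alpha k * c)) = 0 := by
      simp only [← mul_assoc] at h1 ⊢
      rw [h1, zero_mul]
    simpa using h2) (assocElt k H)
  simpa [zigzagβ_assocElt] using h

lemma antipode_bijective [FiniteDimensional k H] {t : H} (ht : IsLeftIntegral k t)
    (ht0 : t ≠ 0) : Function.Bijective (𝒮 : H →ₗ[k] H) :=
  ⟨antipode_injective ht ht0, LinearMap.injective_iff_surjective.mp (antipode_injective ht ht0)⟩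

/-- `antipodeInv` is a `Ring.inverse`, which is $0$ off the units; bijectivity of $S$ is what makes
it a genuine inverse. -/
lemma isUnit_antipode (hS : Function.Bijective (𝒮 : H →ₗ[k] H)) : IsUnit (𝒮 : Module.End k H) := (Module.End.isUnit_iff _).mpr hS

lemma antipode_antipodeInv (hS : Function.Bijective (𝒮 : H →ₗ[k] H)) (h : H) : 𝒮 (antipodeInv k H h) = h :=
  LinearMap.congr_fun (Ring.mul_inverse_cancel _ (isUnit_antipode hS)) h

lemma antipodeInv_antipode (hS : Function.Bijective (𝒮 : H →ₗ[k] H)) (h : H) : antipodeInv k H (𝒮 h) = h :=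
  LinearMap.congr_fun (Ring.inverse_mul_cancel _ (isUnit_antipode hS)) h

lemma antipodeInv_mul (hS : Function.Bijective (𝒮 : H →ₗ[k] H)) (g h : H) :
    antipodeInv k H (g * h) = antipodeInv k H h * antipodeInv k H g := by
  apply hS.1
  simp only [antipode_mul, antipode_antipodeInv hS]

lemma antipodeInv_one (hS : Function.Bijective (𝒮 : H →ₗ[k] H)) : antipodeInv k H 1 = 1 := by
  rw [← antipode_one (k := k), antipodeInv_antipode hS, antipode_one]

end AntipodeBijective

/-! ### Uniqueness of left integrals and the modular element -/

section Uniqueness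

variable (k : Type*) (H : Type*) [Field k] [Ring H] [Algebra k H] [QuasiHopfAlgebra k H]

local notation "𝒮" => QuasiHopfAlgebra.antipode (k := k)

/-- `a ⊗ b ⊗ c ↦ a ⊗ b β S(c)`. -/
def coevalMap₂ : H ⊗[k] (H ⊗[k] H) →ₗ[k] H ⊗[k] H :=
  TensorProduct.map LinearMap.id (coevalMap k H)

/-- `p_R = x¹ ⊗ x² β S(x³)`. -/
def pR : H ⊗[k] H := coevalMap₂ k H (assocInv k H)

/-- `Δ ⊗ I : H ⊗ H → H ⊗ (H ⊗ H)`. -/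
def comulFst : H ⊗[k] H →ₐ[k] H ⊗[k] (H ⊗[k] H) :=
  (Algebra.TensorProduct.assoc k k k H H H).toAlgHom.comp
    (Algebra.TensorProduct.map comul (AlgHom.id k H))

variable {H}

@[simp] lemma coevalMap₂_tmul (a b c : H) :
    coevalMap₂ k H (a ⊗ₜ (b ⊗ₜ c)) = a ⊗ₜ (b * (beta k * 𝒮 c)) := rfl

lemma comulFst_tmul (a b : H) :
    comulFst k H (a ⊗ₜ b) = TensorProduct.assoc k H H H (comul a ⊗ₜ b) := rfl

lemma comulFst_comul (h : H) : comulFst k H (comul h) = comulLeft k h := rfl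

variable (H) in
lemma evalMap₂_assocElt_mul_pR :
    evalMap₂ k H (assocElt k H * comulFst k H (pR k H)) = 1 := by
  have key : ∀ z w : H ⊗[k] (H ⊗[k] H), zigzagα₂ k H (tmulOne k H z * comul₁ k H w) =
      evalMap₂ k H (z * comulFst k H (coevalMap₂ k H w)) := by
    intro z w
    refine ext_tmul₃ k H
      (f := zigzagα₂ k H ∘ₗ LinearMap.mulLeft k (tmulOne k H z) ∘ₗ (comul₁ k H).toLinearMap)
      (g := evalMap₂ k H ∘ₗ LinearMap.mulLeft k z ∘ₗ (comulFst k H).toLinearMap ∘ₗ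
        coevalMap₂ k H) (fun p q r => ?_) w
    refine ext_tmul₃ k H
      (f := zigzagα₂ k H ∘ₗ LinearMap.mulRight k (comul₁ k H (p ⊗ₜ (q ⊗ₜ r))) ∘ₗ
        (tmulOne k H).toLinearMap)
      (g := evalMap₂ k H ∘ₗ
        LinearMap.mulRight k (comulFst k H (coevalMap₂ k H (p ⊗ₜ (q ⊗ₜ r)))))
      (fun x y z => ?_) z
    change zigzagα₂ k H ((x ⊗ₜ (y ⊗ₜ (z ⊗ₜ 1))) *
        TensorProduct.assoc k H H (H ⊗[k] H) (comul p ⊗ₜ (q ⊗ₜ r))) =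
      evalMap₂ k H ((x ⊗ₜ (y ⊗ₜ z)) *
        TensorProduct.assoc k H H H (comul p ⊗ₜ (q * (beta k * 𝒮 r))))
    generalize comul (k := k) p = m
    induction m with
    | zero => simp
    | add m n hm hn => simp only [map_add, add_tmul, mul_add, hm, hn]
    | tmul m n => simp [antipode_mul, mul_assoc]
  rw [pR, ← key, zigzagα₂_tmulOne_mul_comul₁]

lemma evalMap₂_comulRight_mul (h : H) (z : H ⊗[k] (H ⊗[k] H)) :
    evalMap₂ k H (comulRight k h * z) = (h ⊗ₜ 1) * evalMap₂ k H z := by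
  have hw : ∀ w : H ⊗[k] H, evalMap₂ k H (TensorProduct.map LinearMap.id comul.toLinearMap w * z) =
      (TensorProduct.rid k H (TensorProduct.map LinearMap.id counit.toLinearMap w) ⊗ₜ 1) *
        evalMap₂ k H z := by
    intro w
    induction w with
    | zero => simp
    | add v w hv hw => simp only [map_add, add_mul, add_tmul, hv, hw]
    | tmul a b =>
      refine ext_tmul₃ k H
        (f := evalMap₂ k H ∘ₗ LinearMap.mulLeft k
          (TensorProduct.map LinearMap.id comul.toLinearMap (a ⊗ₜ b)))
        (g := LinearMap.mulLeft k (TensorProduct.rid k H (TensorProduct.map LinearMap.id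
          counit.toLinearMap (a ⊗ₜ b)) ⊗ₜ 1) ∘ₗ evalMap₂ k H)
        (fun x y z => ?_) z
      have : ∀ m : H ⊗[k] H, evalMap₂ k H ((a ⊗ₜ m) * (x ⊗ₜ (y ⊗ₜ z))) =
          (a * x) ⊗ₜ (𝒮 y * evalMap k H m * z) := by
        intro m
        induction m with
        | zero => simp
        | add m n hm hn => simp only [map_add, tmul_add, add_mul, mul_add, hm, hn]
        | tmul m n => simp [antipode_mul, mul_assoc]
      have e := this (comul b)
      rw [evalMap_comul] at e
      refine e.trans ?_
      simp [mul_assoc, smul_tmul, smul_mul_assoc]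
  rw [comulRight, hw, counit_right]

variable {k}

/-- This recovers $t$ from $\Delta(t)p_R$, so that nothing is lost in passing from $t$ to the maps
`dualAct f (comul t * pR k H)`. -/
lemma evalMap₂_comul_mul_pR (t : H) :
    evalMap₂ k H (assocElt k H * comulFst k H (comul t * pR k H)) = t ⊗ₜ 1 := by
  rw [map_mul (comulFst k H), ← mul_assoc, comulFst_comul, assocElt_mul_comulLeft, mul_assoc,
    evalMap₂_comulRight_mul, evalMap₂_assocElt_mul_pR, mul_one]

/-- For a functional `f`, the map `a ⊗ b ↦ (y ↦ f(S(b)y) a)`. -/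
def dualAct (f : Module.Dual k H) : H ⊗[k] H →ₗ[k] (H →ₗ[k] H) :=
  TensorProduct.lift
    ((LinearMap.smulRightₗ ∘ₗ (LinearMap.mul k H ∘ₗ 𝒮).compr₂ f :
      H →ₗ[k] H →ₗ[k] (H →ₗ[k] H)).flip)

@[simp] lemma dualAct_tmul (f : Module.Dual k H) (a b y : H) :
    dualAct f (a ⊗ₜ b) y = f (𝒮 b * y) • a := rfl

lemma dualAct_add (f g : Module.Dual k H) (w : H ⊗[k] H) :
    dualAct (f + g) w = dualAct f w + dualAct g w := by
  induction w with
  | zero => simp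
  | add v w hv hw => simp only [map_add, hv, hw]; abel
  | tmul a b => ext y; simp [add_smul]

lemma dualAct_smul (c : k) (f : Module.Dual k H) (w : H ⊗[k] H) :
    dualAct (c • f) w = c • dualAct f w := by
  induction w with
  | zero => simp
  | add v w hv hw => simp only [map_add, hv, hw, smul_add]
  | tmul a b => ext y; simp [mul_smul]

/-- `a ⊗ b ↦ a u(by)`. -/
def applyAct (u : H →ₗ[k] H) (y : H) : H ⊗[k] H →ₗ[k] H :=
  LinearMap.mul' k H ∘ₗ TensorProduct.map LinearMap.id (u ∘ₗ LinearMap.mulRight k y)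

@[simp] lemma applyAct_tmul (u : H →ₗ[k] H) (y a b : H) :
    applyAct u y (a ⊗ₜ b) = a * u (b * y) := rfl

lemma applyAct_add (u v : H →ₗ[k] H) (y : H) (w : H ⊗[k] H) :
    applyAct (u + v) y w = applyAct u y w + applyAct v y w := by
  simp [applyAct, LinearMap.add_comp, TensorProduct.map_add_right]

lemma applyAct_smul (c : k) (u : H →ₗ[k] H) (y : H) (w : H ⊗[k] H) :
    applyAct (c • u) y w = c • applyAct u y w := by
  simp [applyAct, LinearMap.smul_comp, TensorProduct.map_smul_right]

/-- A linear map `u` with `h₁ u(S(h₂)y) = ε(h)u(y)`. -/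
def IsInvariantMap (u : H →ₗ[k] H) : Prop :=
  ∀ h y : H, applyAct u y (TensorProduct.map LinearMap.id 𝒮 (comul h)) =
    counit (k := k) h • u y

lemma IsInvariantMap.add {u v : H →ₗ[k] H} (hu : IsInvariantMap u) (hv : IsInvariantMap v) :
    IsInvariantMap (u + v) := fun h y => by
  rw [applyAct_add, hu, hv, LinearMap.add_apply, smul_add]

/-- Because $S(b)S(h_2)=S(h_2b)$, the invariance condition amounts to
$\Delta(h)\Delta(t)=\varepsilon(h)\Delta(t)$. -/
lemma IsLeftIntegral.isInvariantMap {t : H} (ht : IsLeftIntegral k t) (f : Module.Dual k H) :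
    IsInvariantMap (dualAct f (comul t * pR k H)) := by
  intro h y
  have key : ∀ w v : H ⊗[k] H, applyAct (dualAct f v) y (TensorProduct.map LinearMap.id 𝒮 w) =
      dualAct f (w * v) y := by
    intro w v
    induction v with
    | zero => simp [applyAct]
    | add v v' hv hw => simp only [map_add, applyAct_add, mul_add, hv, hw, LinearMap.add_apply]
    | tmul a b =>
      induction w with
      | zero => simp
      | add v v' hv hw => simp only [map_add, add_mul, hv, hw, LinearMap.add_apply]
      | tmul c d => simp [antipode_mul, mul_assoc]
  rw [key, ← mul_assoc, ht.comul_mul, smul_mul_assoc, map_smul, LinearMap.smul_apply]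

lemma IsInvariantMap.applyAct_comulFst {u : H →ₗ[k] H} (hu : IsInvariantMap u) (y : H)
    (z : H ⊗[k] (H ⊗[k] H)) (w : H ⊗[k] H) :
    applyAct u y (evalMap₂ k H (z * comulFst k H w)) =
      applyAct u (TensorProduct.lid k H (TensorProduct.map counit.toLinearMap LinearMap.id w) * y)
        (evalMap₂ k H z) := by
  refine ext_tmul₃ k H
    (f := applyAct u y ∘ₗ evalMap₂ k H ∘ₗ LinearMap.mulRight k (comulFst k H w))
    (g := applyAct u (TensorProduct.lid k H (TensorProduct.map counit.toLinearMap LinearMap.id w)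
      * y) ∘ₗ evalMap₂ k H) (fun a b c => ?_) z
  simp only [LinearMap.comp_apply, LinearMap.mulRight_apply, evalMap₂_tmul, applyAct_tmul]
  induction w with
  | zero => simp
  | add v w hv hw => simp only [map_add, mul_add, add_mul, hv, hw]
  | tmul p q =>
    have : ∀ m : H ⊗[k] H, applyAct u y (evalMap₂ k H ((a ⊗ₜ (b ⊗ₜ c)) *
        TensorProduct.assoc k H H H (m ⊗ₜ q))) =
        a * applyAct u (𝒮 b * alpha k * c * (q * y)) (TensorProduct.map LinearMap.id 𝒮 m) := by
      intro m
      induction m with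
      | zero => simp
      | add m n hm hn => simp only [map_add, add_tmul, mul_add, hm, hn]
      | tmul m n => simp [antipode_mul, mul_assoc]
    rw [comulFst_tmul, this, hu]
    simp [mul_assoc, mul_smul_comm, smul_mul_assoc]

/-- Put $v(y)=X^1u(S(X^2)\alpha X^3y)$. Quasi-coassociativity makes $v$ left $H$-linear, so $v$ is
determined by $v(1)$. -/
lemma IsInvariantMap.applyAct_mul {u : H →ₗ[k] H} (hu : IsInvariantMap u) (g y : H) :
    applyAct u (g * y) (evalMap₂ k H (assocElt k H)) =
      g * applyAct u y (evalMap₂ k H (assocElt k H)) := by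
  have h := hu.applyAct_comulFst y (assocElt k H) (comul g)
  rw [counit_left, comulFst_comul, assocElt_mul_comulLeft, evalMap₂_comulRight_mul] at h
  rw [← h]
  generalize evalMap₂ k H (assocElt k H) = w
  induction w with
  | zero => simp
  | add v w hv hw => simp only [map_add, mul_add, hv, hw]
  | tmul a b => simp [mul_assoc]

lemma lid_counit_pR : TensorProduct.lid k H
    (TensorProduct.map counit.toLinearMap LinearMap.id (pR k H)) = beta k := by
  have : ∀ w : H ⊗[k] (H ⊗[k] H), TensorProduct.lid k H
      (TensorProduct.map counit.toLinearMap LinearMap.id (coevalMap₂ k H w)) =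
        coevalMap k H (counit₁ k H w) :=
    ext_tmul₃ k H (f := (TensorProduct.lid k H).toLinearMap ∘ₗ
      TensorProduct.map counit.toLinearMap LinearMap.id ∘ₗ coevalMap₂ k H)
      (g := coevalMap k H ∘ₗ (counit₁ k H).toLinearMap) (fun a b c => by simp)
  rw [pR, this, map_assocInv_eq_one k H (counit₁_assocElt k H), Algebra.TensorProduct.one_def]
  simp [antipode_one]

/-- With $v$ as in `IsInvariantMap.applyAct_mul`, this says $v(\beta y)=u(y)$; hence $u(y)=\beta
y\,v(1)$, and an invariant map is determined by one element of $H$. -/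
lemma IsInvariantMap.applyAct_beta_mul {u : H →ₗ[k] H} (hu : IsInvariantMap u) (y : H) :
    applyAct u (beta k * y) (evalMap₂ k H (assocElt k H)) = u y := by
  have h := hu.applyAct_comulFst y (assocElt k H) (pR k H)
  rw [lid_counit_pR, evalMap₂_assocElt_mul_pR, Algebra.TensorProduct.one_def] at h
  rw [← h]
  simp

lemma IsInvariantMap.eq_zero {u : H →ₗ[k] H} (hu : IsInvariantMap u)
    (h : applyAct u 1 (evalMap₂ k H (assocElt k H)) = 0) : u = 0 := by
  ext y
  rw [← hu.applyAct_beta_mul, ← mul_one (beta k * y), hu.applyAct_mul, h, mul_zero,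
    LinearMap.zero_apply]

variable [FiniteDimensional k H]

lemma dualAct_comulFst_eq_zero {f g : Module.Dual k H} {v w : H ⊗[k] H}
    (h : dualAct f v + dualAct g w = 0) (z : H ⊗[k] (H ⊗[k] H)) (y : H) :
    dualAct f (evalMap₂ k H (z * comulFst k H v)) y +
      dualAct g (evalMap₂ k H (z * comulFst k H w)) y = 0 := by
  obtain ⟨c, hc⟩ := TensorProduct.eq_repr_basis_left (Module.finBasis k H) v
  obtain ⟨d, hd⟩ := TensorProduct.eq_repr_basis_left (Module.finBasis k H) w
  set e := Module.finBasis k H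
  rw [Finsupp.sum_fintype _ _ (by simp)] at hc hd
  -- The hypothesis is compared coefficient by coefficient in a basis of the first leg; the
  -- resulting scalar identities survive any operation on that leg, in particular $\Delta$.
  have hcd : ∀ i y, f (𝒮 (c i) * y) + g (𝒮 (d i) * y) = 0 := by
    intro i y
    have h1 := LinearMap.congr_fun h y
    rw [← hc, ← hd, map_sum, map_sum, ← Finset.sum_add_distrib, LinearMap.sum_apply] at h1
    simp only [LinearMap.add_apply, dualAct_tmul, LinearMap.zero_apply, ← add_smul] at h1
    exact Fintype.linearIndependent_iff.mp e.linearIndependent _ h1 i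
  rw [← hc, ← hd]
  simp only [map_sum, Finset.mul_sum, LinearMap.sum_apply]
  rw [← Finset.sum_add_distrib]
  refine Finset.sum_eq_zero fun i _ => ?_
  simp only [comulFst_tmul]
  generalize comul (k := k) (e i) = m
  refine ext_tmul₃ k H
    (f := LinearMap.applyₗ y ∘ₗ
      (dualAct f ∘ₗ evalMap₂ k H ∘ₗ
          LinearMap.mulRight k (TensorProduct.assoc k H H H (m ⊗ₜ c i)) +
        dualAct g ∘ₗ evalMap₂ k H ∘ₗ
          LinearMap.mulRight k (TensorProduct.assoc k H H H (m ⊗ₜ d i))))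
    (g := 0) (fun z₁ z₂ z₃ => ?_) z
  simp only [LinearMap.comp_apply, LinearMap.add_apply, LinearMap.mulRight_apply,
    LinearMap.applyₗ_apply_apply, LinearMap.zero_apply]
  induction m with
  | zero => simp
  | add m n hm hn =>
    simp only [map_add, add_tmul, mul_add, LinearMap.add_apply]
    rw [add_add_add_comm, hm, hn, add_zero]
  | tmul m n =>
    have := hcd i (𝒮 (𝒮 (z₂ * n) * alpha k * z₃) * y)
    simp only [← mul_assoc, ← antipode_mul] at this
    simp only [TensorProduct.assoc_tmul, Algebra.TensorProduct.tmul_mul_tmul, evalMap₂_tmul,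
      dualAct_tmul, ← mul_assoc, ← add_smul, this, zero_smul]

/-- The linear map `f ↦ X¹ u(S(X²) α X³)`, where `u(y) = t₁p_R¹ f(S(t₂p_R²)y)`. -/
def dualToHopf (t : H) : Module.Dual k H →ₗ[k] H where
  toFun f := applyAct (dualAct f (comul t * pR k H)) 1 (evalMap₂ k H (assocElt k H))
  map_add' f g := by rw [dualAct_add, applyAct_add]
  map_smul' c f := by rw [dualAct_smul, applyAct_smul, RingHom.id_apply]

/-- Left integrals are unique up to a scalar. -/
lemma IsLeftIntegral.exists_eq_smul {s t : H} (hs : IsLeftIntegral k s)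
    (ht : IsLeftIntegral k t) (ht0 : t ≠ 0) : ∃ c : k, c • t = s := by
  by_contra! hne
  have hind : LinearIndependent k ![t, s] := (LinearIndependent.pair_iff' ht0).mpr hne
  rw [LinearIndependent.pair_iff] at hind
  -- Two independent integrals would embed $H^*\oplus H^*$ in $H$, contradicting $2\dim H>\dim H$.
  -- For injectivity, a pair with zero image gives a zero invariant map, from which $f(y)t+g(y)s=0$
  -- is recovered for all $y$.
  have hinj : Function.Injective ((dualToHopf t).coprod (dualToHopf (k := k) s)) := by
    rw [injective_iff_map_eq_zero]
    rintro ⟨f, g⟩ hfg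
    have hu := ((ht.isInvariantMap f).add (hs.isInvariantMap g)).eq_zero (by
      rw [applyAct_add]
      exact hfg)
    have hy : ∀ y, f y = 0 ∧ g y = 0 := fun y => by
      have := dualAct_comulFst_eq_zero hu (assocElt k H) y
      rw [evalMap₂_comul_mul_pR, evalMap₂_comul_mul_pR] at this
      exact hind _ _ (by simpa [antipode_one] using this)
    exact Prod.ext (LinearMap.ext fun y => (hy y).1) (LinearMap.ext fun y => (hy y).2)
  have hle := LinearMap.finrank_le_finrank_of_injective hinj
  rw [Module.finrank_prod, Subspace.dual_finrank_eq] at hle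
  have : Nontrivial H := ⟨t, 0, ht0⟩
  have := Module.finrank_pos (R := k) (M := H)
  omega

/-- Each $th$ is again a left integral, hence a multiple of $t$; cancelling $t\neq0$ shows that the
coefficient is an algebra morphism in $h$, so `modular` does not take its default value $0$. -/
lemma IsLeftIntegral.mul_eq_modular_smul {t : H} (ht : IsLeftIntegral k t) (ht0 : t ≠ 0) (h : H) :
    t * h = modular k t h • t := by
  have hex : ∀ h : H, ∃ c : k, c • t = t * h := fun h =>
    IsLeftIntegral.exists_eq_smul (fun g => by rw [← mul_assoc, ht g, smul_mul_assoc]) ht ht0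
  choose γ hγ using hex
  have hinj : ∀ {c d : k}, c • t = d • t → c = d := fun hcd => smul_left_injective k ht0 hcd
  have hex : ∃ γ : H →ₐ[k] k, ∀ h : H, t * h = γ h • t := by
    refine ⟨AlgHom.ofLinearMap
      { toFun := γ
        map_add' := fun a b => hinj (by rw [hγ, mul_add, add_smul, hγ, hγ])
        map_smul' := fun c a => hinj (by
          rw [hγ, mul_smul_comm, RingHom.id_apply, smul_eq_mul, mul_smul, hγ]) }
      (hinj (by change γ 1 • t = _; rw [hγ, mul_one, one_smul]))
      (fun a b => hinj (by
        change γ (a * b) • t = (γ a * γ b) • t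
        rw [hγ, ← mul_assoc, ← hγ a, smul_mul_assoc, ← hγ b, mul_smul])),
      fun h => (hγ h).symm⟩
  rw [modular, dif_pos hex]
  exact hex.choose_spec h

end Uniqueness

/-! ### Identities for $p_L$ and $q_L$ -/

section LeftElements

variable (k : Type*) (H : Type*) [Field k] [Ring H] [Algebra k H] [QuasiHopfAlgebra k H]

local notation "𝒮" => QuasiHopfAlgebra.antipode (k := k)

/-- `a ⊗ b ↦ b S⁻¹(aβ)`. -/
def coevalInv : H ⊗[k] H →ₗ[k] H :=
  LinearMap.mul' k H ∘ₗ (TensorProduct.comm k H H).toLinearMap ∘ₗ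
    TensorProduct.map (antipodeInv k H ∘ₗ LinearMap.mulRight k (beta k : H)) LinearMap.id

/-- `a ⊗ b ⊗ r ↦ b S⁻¹(aβ) ⊗ r`. -/
def coevalInv₁ (M : Type*) [AddCommGroup M] [Module k M] :
    H ⊗[k] (H ⊗[k] M) →ₗ[k] H ⊗[k] M :=
  TensorProduct.map (coevalInv k H) LinearMap.id ∘ₗ (TensorProduct.assoc k H H M).symm.toLinearMap

/-- `I ⊗ Δ : H ⊗ H → H ⊗ (H ⊗ H)`. -/
def comulSnd : H ⊗[k] H →ₗ[k] H ⊗[k] (H ⊗[k] H) :=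
  TensorProduct.map LinearMap.id comul.toLinearMap

variable {H}

@[simp] lemma coevalInv_tmul (a b : H) :
    coevalInv k H (a ⊗ₜ b) = b * antipodeInv k H (a * beta k) := rfl

@[simp] lemma coevalInv₁_tmul {M : Type*} [AddCommGroup M] [Module k M] (a b : H) (m : M) :
    coevalInv₁ k H M (a ⊗ₜ (b ⊗ₜ m)) = (b * antipodeInv k H (a * beta k)) ⊗ₜ m := rfl

variable (H) in
lemma pL_eq : pL k H = coevalInv₁ k H H (assocElt k H) := rfl

lemma coevalInv_comul (hS : Function.Bijective (𝒮 : H →ₗ[k] H)) (h : H) :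
    coevalInv k H (comul h) = counit (k := k) h • antipodeInv k H (beta k) := by
  have : ∀ w : H ⊗[k] H, coevalInv k H w = antipodeInv k H (coevalMap k H w) := by
    intro w
    induction w with
    | zero => simp
    | add v w hv hw => simp only [map_add, hv, hw]
    | tmul a b =>
      rw [coevalMap_tmul, ← mul_assoc, antipodeInv_mul hS, antipodeInv_antipode hS,
        coevalInv_tmul]
  rw [this, coevalMap_comul, map_smul]

lemma coevalInv₁_tmul_mul (hS : Function.Bijective (𝒮 : H →ₗ[k] H)) (h : H) (m : H ⊗[k] H)
    (z : H ⊗[k] (H ⊗[k] H)) :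
    coevalInv₁ k H H ((h ⊗ₜ m) * z) = m * (coevalInv₁ k H H z * (antipodeInv k H h ⊗ₜ 1)) := by
  refine ext_tmul₃ k H (f := coevalInv₁ k H H ∘ₗ LinearMap.mulLeft k (h ⊗ₜ m))
    (g := LinearMap.mulLeft k m ∘ₗ LinearMap.mulRight k (antipodeInv k H h ⊗ₜ 1) ∘ₗ
      coevalInv₁ k H H) (fun a b c => ?_) z
  induction m with
  | zero => simp
  | add m n hm hn =>
    simp only [LinearMap.comp_apply, LinearMap.mulLeft_apply] at hm hn ⊢
    simp only [tmul_add, add_mul, map_add, hm, hn]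
  | tmul m n => simp [antipodeInv_mul hS, mul_assoc]

lemma coevalInv₁_mul_comulFst (hS : Function.Bijective (𝒮 : H →ₗ[k] H))
    (z : H ⊗[k] (H ⊗[k] H)) (w : H ⊗[k] H) :
    coevalInv₁ k H H (z * comulFst k H w) = coevalInv₁ k H H z *
      (1 ⊗ₜ TensorProduct.lid k H (TensorProduct.map counit.toLinearMap LinearMap.id w)) := by
  induction w with
  | zero => simp
  | add v w hv hw => simp only [map_add, mul_add, tmul_add, hv, hw]
  | tmul p q =>
    rw [comulFst_tmul]
    refine ext_tmul₃ k H
      (f := coevalInv₁ k H H ∘ₗ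
        LinearMap.mulRight k (TensorProduct.assoc k H H H (comul p ⊗ₜ q)))
      (g := LinearMap.mulRight k (1 ⊗ₜ TensorProduct.lid k H
        (TensorProduct.map counit.toLinearMap LinearMap.id (p ⊗ₜ q))) ∘ₗ
          coevalInv₁ k H H) (fun a b c => ?_) z
    have : ∀ m : H ⊗[k] H,
        coevalInv₁ k H H ((a ⊗ₜ (b ⊗ₜ c)) * TensorProduct.assoc k H H H (m ⊗ₜ q)) =
          (b * (coevalInv k H m * antipodeInv k H a)) ⊗ₜ (c * q) := by
      intro m
      induction m with
      | zero => simp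
      | add m n hm hn => simp only [map_add, add_tmul, add_mul, mul_add, hm, hn]
      | tmul m n => simp [antipodeInv_mul hS, mul_assoc]
    have e := this (comul p)
    rw [coevalInv_comul k hS] at e
    refine e.trans ?_
    simp [antipodeInv_mul hS, smul_mul_assoc, mul_smul_comm, smul_tmul]

/-- `a ⊗ b ↦ Δ(b) p_L (S⁻¹(a) ⊗ 1)`. -/
def pLTwist : H ⊗[k] H →ₗ[k] H ⊗[k] H :=
  TensorProduct.lift
    ((LinearMap.mul k (H ⊗[k] H)).compl₁₂ (comul (k := k) (H := H)).toLinearMap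
      (LinearMap.mulLeft k (pL k H) ∘ₗ (TensorProduct.mk k H H).flip 1 ∘ₗ antipodeInv k H)).flip

@[simp] lemma pLTwist_tmul (a b : H) :
    pLTwist k (a ⊗ₜ b) = comul b * (pL k H * (antipodeInv k H a ⊗ₜ 1)) := rfl

/-- `Δ(h₂) p_L (S⁻¹(h₁) ⊗ 1) = p_L (1 ⊗ h)`. -/
lemma pLTwist_comul (hS : Function.Bijective (𝒮 : H →ₗ[k] H)) (h : H) :
    pLTwist k (comul h) = pL k H * (1 ⊗ₜ h) := by
  -- Contract $\phi(\Delta\otimes I)\Delta(h)=(I\otimes\Delta)\Delta(h)\phi$ by $a\otimes b\mapsto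
  -- bS^{-1}(a\beta)$ in the first two legs.
  have e := coevalInv₁_mul_comulFst k hS (assocElt k H) (comul h)
  rw [counit_left, comulFst_comul, assocElt_mul_comulLeft, ← pL_eq] at e
  rw [← e, comulRight]
  generalize comul (k := k) h = w
  induction w with
  | zero => simp
  | add v w hv hw => simp only [map_add, add_mul, hv, hw]
  | tmul a b =>
    rw [TensorProduct.map_tmul, coevalInv₁_tmul_mul k hS]
    rfl

/-- `Δ(q_L²) p_L (S⁻¹(q_L¹) ⊗ 1) = 1 ⊗ 1`. -/
lemma pLTwist_qL (hS : Function.Bijective (𝒮 : H →ₗ[k] H)) : pLTwist k (qL k H) = 1 := by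
  -- Applying $S$ to the first leg turns the desired expression into the contraction evaluated in
  -- `zigzagα₁_comul₃_mul_oneTmul`; afterwards $S^{-1}\otimes I$ undoes it.
  have key : ∀ w z : H ⊗[k] (H ⊗[k] H),
      zigzagα₁ k H (comul₃ k H w * oneTmul k H z) =
        TensorProduct.map 𝒮 LinearMap.id (TensorProduct.lift
          ((LinearMap.mul k (H ⊗[k] H)).compl₁₂ (comul (k := k) (H := H)).toLinearMap
            (LinearMap.mulLeft k (coevalInv₁ k H H z) ∘ₗ (TensorProduct.mk k H H).flip 1 ∘ₗ
              antipodeInv k H)).flip (evalMap₁ k H w)) := by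
    intro w z
    refine ext_tmul₃ k H
      (f := zigzagα₁ k H ∘ₗ LinearMap.mulRight k (oneTmul k H z) ∘ₗ (comul₃ k H).toLinearMap)
      (g := TensorProduct.map 𝒮 LinearMap.id ∘ₗ TensorProduct.lift
        ((LinearMap.mul k (H ⊗[k] H)).compl₁₂ (comul (k := k) (H := H)).toLinearMap
            (LinearMap.mulLeft k (coevalInv₁ k H H z) ∘ₗ (TensorProduct.mk k H H).flip 1 ∘ₗ
              antipodeInv k H)).flip ∘ₗ evalMap₁ k H) (fun p q r => ?_) w
    refine ext_tmul₃ k H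
      (f := zigzagα₁ k H ∘ₗ LinearMap.mulLeft k (comul₃ k H (p ⊗ₜ (q ⊗ₜ r))) ∘ₗ
        (oneTmul k H).toLinearMap)
      (g := TensorProduct.map 𝒮 LinearMap.id ∘ₗ LinearMap.mulLeft k (comul r) ∘ₗ
        LinearMap.mulRight k (antipodeInv k H (𝒮 p * alpha k * q) ⊗ₜ 1) ∘ₗ
          coevalInv₁ k H H) (fun x y z => ?_) z
    change zigzagα₁ k H ((p ⊗ₜ (q ⊗ₜ comul r)) * (1 ⊗ₜ (x ⊗ₜ (y ⊗ₜ z)))) =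
      TensorProduct.map 𝒮 LinearMap.id (comul r *
        (((y * antipodeInv k H (x * beta k)) ⊗ₜ z) *
          (antipodeInv k H (𝒮 p * alpha k * q) ⊗ₜ 1)))
    generalize comul (k := k) r = m
    induction m with
    | zero => simp
    | add m n hm hn => simp only [map_add, tmul_add, add_mul, hm, hn]
    | tmul m n => simp [antipode_mul, antipode_antipodeInv hS, mul_assoc]
  have e := key (assocInv k H) (assocElt k H)
  rw [zigzagα₁_comul₃_mul_oneTmul] at e
  have e' := congrArg (TensorProduct.map (antipodeInv k H) LinearMap.id) e
  rw [← LinearMap.comp_apply (TensorProduct.map (antipodeInv k H) LinearMap.id),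
    ← TensorProduct.map_comp,
    show antipodeInv k H ∘ₗ 𝒮 = LinearMap.id from LinearMap.ext (antipodeInv_antipode hS),
    LinearMap.id_comp, TensorProduct.map_id, LinearMap.id_apply,
    Algebra.TensorProduct.one_def, TensorProduct.map_tmul, antipodeInv_one hS] at e'
  exact e'.symm

variable {k}

/-- `Δ(t) Δ(w²) p_L (S⁻¹(w¹) ⊗ 1) = Δ(t) p_L (S⁻¹(γ(w²)w¹) ⊗ 1)`. -/
lemma comul_mul_pLTwist {t : H} {γ : H →ₗ[k] k} (hγ : ∀ h, t * h = γ h • t) (w : H ⊗[k] H) :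
    comul (k := k) t * pLTwist k w =
      comul t * (pL k H * (antipodeInv k H (evalRight k γ w) ⊗ₜ 1)) := by
  induction w with
  | zero => simp
  | add v w hv hw => simp only [map_add, mul_add, add_tmul, hv, hw]
  | tmul a b =>
    rw [pLTwist_tmul, ← mul_assoc, ← map_mul, hγ, map_smul]
    simp [evalRight, ← smul_tmul', smul_mul_assoc, mul_smul_comm]

lemma coevalInv₁_mul_comul₁ (hS : Function.Bijective (𝒮 : H →ₗ[k] H))
    (w : H ⊗[k] (H ⊗[k] H)) (hw : counit₁ k H w = 1) (v : H ⊗[k] (H ⊗[k] (H ⊗[k] H))) :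
    coevalInv₁ k H _ (v * comul₁ k H w) = coevalInv₁ k H _ v := by
  refine absorb_right k H _ _ (counit₁ k H) (unit₁ k H) (fun p q r x y z u => ?_) w hw v
  have : ∀ m : H ⊗[k] H, coevalInv₁ k H _
      ((x ⊗ₜ (y ⊗ₜ (z ⊗ₜ u))) * (TensorProduct.assoc k H H (H ⊗[k] H) (m ⊗ₜ (q ⊗ₜ r)))) =
      (y * (coevalInv k H m * antipodeInv k H x)) ⊗ₜ ((z * q) ⊗ₜ (u * r)) := by
    intro m
    induction m with
    | zero => simp
    | add m n hm hn => simp only [map_add, add_tmul, add_mul, mul_add, hm, hn]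
    | tmul m n => simp [antipodeInv_mul hS, mul_assoc]
  rw [comul₁_tmul, this, coevalInv_comul k hS]
  simp [antipodeInv_mul hS, mul_assoc, smul_mul_assoc, mul_smul_comm, smul_tmul]

lemma coevalInv₁_oneTmul_mul (z : H ⊗[k] (H ⊗[k] H)) (v : H ⊗[k] (H ⊗[k] (H ⊗[k] H))) :
    coevalInv₁ k H _ (oneTmul k H z * v) = z * coevalInv₁ k H _ v := by
  refine ext_mul₃₄ k H
    (f := (LinearMap.mul k (H ⊗[k] (H ⊗[k] (H ⊗[k] H)))).compr₂ (coevalInv₁ k H _) ∘ₗ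
      (oneTmul k H).toLinearMap)
    (g := (LinearMap.mul k (H ⊗[k] (H ⊗[k] H))).compl₂ (coevalInv₁ k H _))
    (fun a b c x y z u => ?_) z v
  simp [mul_assoc]

lemma coevalInv₁_comul₃ (w : H ⊗[k] (H ⊗[k] H)) :
    coevalInv₁ k H _ (comul₃ k H w) = comulSnd k H (coevalInv₁ k H H w) :=
  ext_tmul₃ k H (f := coevalInv₁ k H _ ∘ₗ (comul₃ k H).toLinearMap)
    (g := comulSnd k H ∘ₗ coevalInv₁ k H H) (fun _ _ _ => rfl) w

variable (k) in
/-- `a ⊗ b ⊗ c ↦ Δ(b) z (S⁻¹(a) ⊗ 1) ⊗ c`, rebracketed. -/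
def twist₃ (z : H ⊗[k] H) : H ⊗[k] (H ⊗[k] H) →ₗ[k] H ⊗[k] (H ⊗[k] H) :=
  (TensorProduct.assoc k H H H).toLinearMap ∘ₗ
    TensorProduct.map (TensorProduct.lift
      ((LinearMap.mul k (H ⊗[k] H)).compl₁₂ (comul (k := k) (H := H)).toLinearMap
        (LinearMap.mulLeft k z ∘ₗ (TensorProduct.mk k H H).flip 1 ∘ₗ antipodeInv k H)).flip)
      LinearMap.id ∘ₗ (TensorProduct.assoc k H H H).symm.toLinearMap

@[simp] lemma twist₃_tmul (z : H ⊗[k] H) (a b c : H) :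
    twist₃ k z (a ⊗ₜ (b ⊗ₜ c)) =
      TensorProduct.assoc k H H H ((comul b * (z * (antipodeInv k H a ⊗ₜ 1))) ⊗ₜ c) := rfl

lemma coevalInv₁_comul₂_mul_tmulOne (hS : Function.Bijective (𝒮 : H →ₗ[k] H))
    (w z : H ⊗[k] (H ⊗[k] H)) :
    coevalInv₁ k H _ (comul₂ k H w * tmulOne k H z) = twist₃ k (coevalInv₁ k H H z) w := by
  refine ext_tmul₃ k H
    (f := coevalInv₁ k H _ ∘ₗ LinearMap.mulRight k (tmulOne k H z) ∘ₗ (comul₂ k H).toLinearMap)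
    (g := twist₃ k (coevalInv₁ k H H z)) (fun p q r => ?_) w
  refine ext_tmul₃ k H
    (f := coevalInv₁ k H _ ∘ₗ LinearMap.mulLeft k (comul₂ k H (p ⊗ₜ (q ⊗ₜ r))) ∘ₗ
      (tmulOne k H).toLinearMap)
    (g := (TensorProduct.assoc k H H H).toLinearMap ∘ₗ (TensorProduct.mk k (H ⊗[k] H) H).flip r ∘ₗ
      LinearMap.mulLeft k (comul q) ∘ₗ LinearMap.mulRight k (antipodeInv k H p ⊗ₜ 1) ∘ₗ
        coevalInv₁ k H H) (fun x y z => ?_) z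
  change coevalInv₁ k H _ ((p ⊗ₜ TensorProduct.assoc k H H H (comul q ⊗ₜ r)) *
      (x ⊗ₜ (y ⊗ₜ (z ⊗ₜ 1)))) =
    TensorProduct.assoc k H H H ((comul q * (((y * antipodeInv k H (x * beta k)) ⊗ₜ z) *
      (antipodeInv k H p ⊗ₜ 1))) ⊗ₜ r)
  generalize comul (k := k) q = m
  induction m with
  | zero => simp
  | add m n hm hn => simp only [map_add, tmul_add, add_tmul, add_mul, hm, hn]
  | tmul m n => simp [antipodeInv_mul hS, mul_assoc]

/-- `Y¹X²₁p_L¹S⁻¹(X¹) ⊗ Y²X²₂p_L² ⊗ Y³X³ = p_L¹ ⊗ Δ(p_L²)`. -/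
lemma assocElt_mul_twist₃ (hS : Function.Bijective (𝒮 : H →ₗ[k] H)) :
    assocElt k H * twist₃ k (pL k H) (assocElt k H) = comulSnd k H (pL k H) := by
  -- Contracting the first two legs of the pentagon absorbs $(\Delta\otimes I\otimes I)(\phi)$ and
  -- lets $1\otimes\phi$ out as a left factor.
  have h := congrArg (coevalInv₁ k H (H ⊗[k] H)) (pentagon' k H)
  rw [coevalInv₁_mul_comul₁ hS _ (counit₁_assocElt k H), coevalInv₁_comul₃, mul_assoc,
    coevalInv₁_oneTmul_mul, coevalInv₁_comul₂_mul_tmulOne hS, ← pL_eq] at h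
  exact h.symm

end LeftElements

/-! ### The counit on $S$, $\alpha$, $\beta$, $p_L$, $q_L$ -/

section Counit

variable {k : Type*} {H : Type*} [Field k] [Ring H] [Algebra k H] [QuasiHopfAlgebra k H]

local notation "𝒮" => QuasiHopfAlgebra.antipode (k := k)

local notation "ε" => QuasiBialgebra.counit (k := k) (H := H)

-- Applying $\varepsilon$ to $X^1\beta S(X^2)\alpha X^3=1$ shows that
-- $\varepsilon(\alpha)\varepsilon(\beta)$ divides $1$. Both scalars are later inverted to
-- normalise.
variable (k H) in
lemma counit_alpha_beta_ne_zero : ε (alpha k) ≠ 0 ∧ ε (beta k) ≠ 0 := by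
  have h := ext_tmul₃ k H (f := (ε).toLinearMap ∘ₗ zigzagβ k H)
    (g := (ε (alpha k) * ε (beta k)) • LinearMap.mul' k k ∘ₗ
      TensorProduct.map (ε).toLinearMap (LinearMap.mul' k k ∘ₗ
        TensorProduct.map ((ε).toLinearMap ∘ₗ 𝒮) (ε).toLinearMap))
    (fun a b c => by simp; ring) (assocElt k H)
  rw [LinearMap.comp_apply, zigzagβ_assocElt, AlgHom.toLinearMap_apply, map_one] at h
  constructor
  · intro h0
    simp [h0] at h
  · intro h0
    simp [h0] at h

/-- Apply $\varepsilon$ to $S(h_1)\alpha h_2=\varepsilon(h)\alpha$ and cancel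
$\varepsilon(\alpha)\neq0$. -/
lemma counit_antipode (h : H) : ε (𝒮 h) = ε h := by
  have key : ∀ w : H ⊗[k] H, ε (evalMap k H w) =
      ε (𝒮 (TensorProduct.rid k H (TensorProduct.map LinearMap.id (ε).toLinearMap w))) *
        ε (alpha k) := by
    intro w
    induction w with
    | zero => simp
    | add v w hv hw => simp only [map_add, hv, hw, add_mul]
    | tmul a b => simp; ring
  have e := key (comul h)
  rw [counit_right, evalMap_comul, map_smul, smul_eq_mul] at e
  exact (mul_right_cancel₀ (counit_alpha_beta_ne_zero k H).1 e).symm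

lemma counit_antipodeInv (hS : Function.Bijective (𝒮 : H →ₗ[k] H)) (h : H) :
    ε (antipodeInv k H h) = ε h := by
  rw [← counit_antipode, antipode_antipodeInv hS]

lemma lid_counit_pL (hS : Function.Bijective (𝒮 : H →ₗ[k] H)) :
    TensorProduct.lid k H (TensorProduct.map (ε).toLinearMap LinearMap.id (pL k H)) =
      ε (beta k) • 1 := by
  have := ext_tmul₃ k H (f := (TensorProduct.lid k H).toLinearMap ∘ₗ
      TensorProduct.map (ε).toLinearMap LinearMap.id ∘ₗ coevalInv₁ k H H)
    (g := ε (beta k) • (TensorProduct.lid k H).toLinearMap ∘ₗ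
      TensorProduct.map (ε).toLinearMap LinearMap.id ∘ₗ (counit₁ k H).toLinearMap)
    (fun a b c => by
      simp [counit_antipodeInv hS, smul_smul, mul_comm, mul_left_comm]) (assocElt k H)
  rw [pL_eq]
  refine this.trans ?_
  simp [counit₁_assocElt, Algebra.TensorProduct.one_def]

lemma lid_counit_qL :
    TensorProduct.lid k H (TensorProduct.map (ε).toLinearMap LinearMap.id (qL k H)) =
      ε (alpha k) • 1 := by
  have := ext_tmul₃ k H (f := (TensorProduct.lid k H).toLinearMap ∘ₗ
      TensorProduct.map (ε).toLinearMap LinearMap.id ∘ₗ evalMap₁ k H)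
    (g := ε (alpha k) • (TensorProduct.lid k H).toLinearMap ∘ₗ
      TensorProduct.map (ε).toLinearMap LinearMap.id ∘ₗ (counit₁ k H).toLinearMap)
    (fun a b c => by
      simp [counit_antipode, smul_smul, mul_comm, mul_left_comm]) (assocInv k H)
  rw [qL_eq]
  refine this.trans ?_
  simp [map_assocInv_eq_one k H (counit₁_assocElt k H), Algebra.TensorProduct.one_def]

lemma lid_counit_mul (v w : H ⊗[k] H) :
    TensorProduct.lid k H (TensorProduct.map (ε).toLinearMap LinearMap.id (v * w)) =
      TensorProduct.lid k H (TensorProduct.map (ε).toLinearMap LinearMap.id v) *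
        TensorProduct.lid k H (TensorProduct.map (ε).toLinearMap LinearMap.id w) :=
  map_mul ((Algebra.TensorProduct.lid k H).toAlgHom.comp
    (Algebra.TensorProduct.map counit (AlgHom.id k H))) v w

end Counit

/-! ### An $H$-linear map $H^*\to H$ built from $t$ -/

section DualToIntegral

variable {k : Type*} {H : Type*} [Field k] [Ring H] [Algebra k H] [QuasiHopfAlgebra k H]

local notation "𝒮" => QuasiHopfAlgebra.antipode (k := k)

/-- `f ↦ f(S⁻¹(w¹)) w²`. -/
def dualContract (w : H ⊗[k] H) : Module.Dual k H →ₗ[k] H where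
  toFun f := TensorProduct.lid k H (TensorProduct.map (f ∘ₗ antipodeInv k H) LinearMap.id w)
  map_add' f g := by
    rw [LinearMap.add_comp, TensorProduct.map_add_left, LinearMap.add_apply, map_add]
  map_smul' c f := by
    rw [LinearMap.smul_comp, TensorProduct.map_smul_left, LinearMap.smul_apply, map_smul,
      RingHom.id_apply]

lemma dualContract_apply (w : H ⊗[k] H) (f : Module.Dual k H) : dualContract w f =
    TensorProduct.lid k H (TensorProduct.map (f ∘ₗ antipodeInv k H) LinearMap.id w) := rfl

/-- Since $S^{-1}(w^1)h=S^{-1}(S(h)w^1)$, linearity is exactly the rule that $S(h)\otimes1$ and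
$1\otimes h$ agree in front of $q_L\Delta(t)$. -/
lemma IsLeftIntegral.dualContract_mulRight (hS : Function.Bijective (𝒮 : H →ₗ[k] H)) {t : H}
    (ht : IsLeftIntegral k t) (h : H) (f : Module.Dual k H) :
    dualContract (qL k H * comul t) (f ∘ₗ LinearMap.mulRight k h) =
      h * dualContract (qL k H * comul t) f := by
  have h1 : ∀ w : H ⊗[k] H, dualContract w (f ∘ₗ LinearMap.mulRight k h) =
      dualContract ((𝒮 h ⊗ₜ 1) * w) f := by
    intro w
    induction w with
    | zero => simp [dualContract_apply]
    | add v w hv hw => simp only [dualContract_apply, map_add, mul_add] at hv hw ⊢; rw [hv, hw]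
    | tmul a b => simp [dualContract_apply, antipodeInv_mul hS, antipodeInv_antipode hS]
  have h2 : ∀ w : H ⊗[k] H, h * dualContract w f = dualContract ((1 ⊗ₜ h) * w) f := by
    intro w
    induction w with
    | zero => simp [dualContract_apply]
    | add v w hv hw => simp only [dualContract_apply, map_add, mul_add] at hv hw ⊢; rw [hv, hw]
    | tmul a b => simp [dualContract_apply, mul_smul_comm]
  rw [h1, h2, ht.one_tmul_mul]

lemma dualContract_counit (hS : Function.Bijective (𝒮 : H →ₗ[k] H)) (t : H) :
    dualContract (qL k H * comul t) (counit (k := k) (H := H)).toLinearMap =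
      counit (k := k) (alpha k : H) • t := by
  have : (counit (k := k) (H := H)).toLinearMap ∘ₗ antipodeInv k H =
      (counit (k := k) (H := H)).toLinearMap := LinearMap.ext (counit_antipodeInv hS)
  rw [dualContract_apply, this, lid_counit_mul, lid_counit_qL, counit_left, smul_one_mul]

end DualToIntegral

/-! ### The Morita map and the three equivalent conditions -/

section Morita

variable {k : Type*} {H : Type*} {A : Type*} [Field k] [Ring H] [Algebra k H]
  [QuasiHopfAlgebra k H] [NonAssocRing A] [Module k A] [IsScalarTower k A A]
  [SMulCommClass k A A] [Module H A] [IsScalarTower k H A]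

local notation "𝒮" => QuasiHopfAlgebra.antipode (k := k)

variable (k H A) in
/-- `g ⊗ h ↦ (a ⊗ b ↦ (g·a)(h·b))`. -/
def pairAct : H ⊗[k] H →ₗ[k] (A ⊗[k] A →ₗ[k] A) :=
  (LinearMap.mul' k A).compRight k ∘ₗ
    TensorProduct.homTensorHomMap (RingHom.id k) A A A A ∘ₗ
      TensorProduct.map (Algebra.lsmul k k A : H →ₐ[k] Module.End k A).toLinearMap
        (Algebra.lsmul k k A : H →ₐ[k] Module.End k A).toLinearMap

@[simp] lemma pairAct_tmul (g h : H) (a b : A) :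
    pairAct k H A (g ⊗ₜ h) (a ⊗ₜ b) = (g • a) * (h • b) := rfl

lemma pMul_eq : pMul k H A = pairAct k H A (pL k H) := rfl

lemma pairAct_smul_smul (w : H ⊗[k] H) (g h : H) (a b : A) :
    pairAct k H A w ((g • a) ⊗ₜ (h • b)) = pairAct k H A (w * (g ⊗ₜ h)) (a ⊗ₜ b) := by
  induction w with
  | zero => simp
  | add v w hv hw => simp only [map_add, add_mul, LinearMap.add_apply, hv, hw]
  | tmul p q => simp [mul_smul]

/-- `a ⊗ b ⊗ c` acts on `x, y, z` by `(a·x)[(b·y)(c·z)]`. -/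
def tripleAct (x y z : A) : H ⊗[k] (H ⊗[k] H) →ₗ[k] A :=
  LinearMap.mul' k A ∘ₗ TensorProduct.map (orbit k H x)
    (LinearMap.mul' k A ∘ₗ TensorProduct.map (orbit k H y) (orbit k H z))

@[simp] lemma tripleAct_tmul (x y z : A) (a b c : H) :
    tripleAct (k := k) x y z (a ⊗ₜ (b ⊗ₜ c)) = (a • x) * ((b • y) * (c • z)) := rfl

lemma tripleAct_smul (x y z : A) (a b c : H) (w : H ⊗[k] (H ⊗[k] H)) :
    tripleAct (a • x) (b • y) (c • z) w = tripleAct x y z (w * (a ⊗ₜ (b ⊗ₜ c))) :=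
  ext_tmul₃ k H (f := tripleAct (a • x) (b • y) (c • z))
    (g := tripleAct x y z ∘ₗ LinearMap.mulRight k (a ⊗ₜ (b ⊗ₜ c)))
    (fun p q r => by simp [mul_smul]) w

variable [IsModuleAlgebra k H A]

lemma smul_mul_eq_pairAct (h : H) (a b : A) :
    h • (a * b) = pairAct k H A (comul h) (a ⊗ₜ b) := by
  rw [IsModuleAlgebra.smul_mul' (k := k) h a b]
  generalize comul (k := k) h = w
  induction w with
  | zero => simp
  | add v w hv hw => simp only [map_add, LinearMap.add_apply, hv, hw]
  | tmul p q => rfl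

lemma smul_pairAct (h : H) (w : H ⊗[k] H) (z : A ⊗[k] A) :
    h • pairAct k H A w z = pairAct k H A (comul h * w) z := by
  induction z with
  | zero => simp
  | add x y hx hy => simp only [map_add, smul_add, hx, hy]
  | tmul a b =>
    induction w with
    | zero => simp
    | add v w hv hw => simp only [map_add, mul_add, smul_add, LinearMap.add_apply, hv, hw]
    | tmul p q => rw [pairAct_tmul, smul_mul_eq_pairAct (k := k), pairAct_smul_smul]

lemma mul_mul_eq_tripleAct (a b c : A) :
    (a * b) * c = tripleAct a b c (assocElt k H) :=
  IsModuleAlgebra.mul_assoc' (k := k) (H := H) a b c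

lemma pairAct_mul_smul (w : H ⊗[k] H) (h : H) (a b c : A) :
    pairAct k H A w (a ⊗ₜ b) * (h • c) =
      tripleAct a b c (assocElt k H * TensorProduct.assoc k H H H (w ⊗ₜ h)) := by
  induction w with
  | zero => simp
  | add v w hv hw => simp only [map_add, LinearMap.add_apply, add_mul, add_tmul, mul_add, hv, hw]
  | tmul p q =>
    rw [pairAct_tmul, mul_mul_eq_tripleAct (k := k) (H := H), tripleAct_smul,
      TensorProduct.assoc_tmul]

lemma pMul_tmul_mul (a b c : A) :
    pMul k H A (a ⊗ₜ (b * c)) = tripleAct a b c (comulSnd k H (pL k H)) := by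
  rw [pMul_eq]
  generalize pL k H = w
  induction w with
  | zero => simp
  | add v w hv hw => simp only [map_add, LinearMap.add_apply, hv, hw]
  | tmul p q =>
    rw [pairAct_tmul, IsModuleAlgebra.smul_mul' (k := k)]
    rfl

/-- Write $p_L(1\otimes g)=\Delta(g_2)p_L(S^{-1}(g_1)\otimes1)$ and use $tg_2=\gamma(g_2)t$. This
accounts for $\gamma\rightharpoonup$ in the right action. -/
lemma smul_pMul_smul {t : H} {γ : H →ₗ[k] k}
    (hS : Function.Bijective (𝒮 : H →ₗ[k] H)) (hγ : ∀ h, t * h = γ h • t) (g : H) (a c : A) :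
    t • pMul k H A (a ⊗ₜ (g • c)) =
      t • pMul k H A ((antipodeInv k H (hit k γ g) • a) ⊗ₜ c) := by
  have h1 := pairAct_smul_smul (k := k) (pL k H) 1 g a c
  have h2 := pairAct_smul_smul (k := k) (pL k H) (antipodeInv k H (hit k γ g)) 1 a c
  rw [one_smul] at h1 h2
  rw [pMul_eq, h1, h2, smul_pairAct, smul_pairAct, ← pLTwist_comul k hS,
    comul_mul_pLTwist hγ]
  rfl

/-- Here $t q_L^2=\gamma(q_L^2)t$ is used backwards, after which
$\Delta(q_L^2)p_L(S^{-1}(q_L^1)\otimes1)=1\otimes 1$ makes $p_L$ disappear. This accounts for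
$\Lambda$. -/
lemma smul_pMul_lam {t : H} {γ : H →ₗ[k] k}
    (hS : Function.Bijective (𝒮 : H →ₗ[k] H)) (hγ : ∀ h, t * h = γ h • t) (z c : A) :
    t • pMul k H A ((antipodeInv k H (Lam k γ) • z) ⊗ₜ c) = t • (z * c) := by
  have h2 := pairAct_smul_smul (k := k) (pL k H) (antipodeInv k H (Lam k γ)) 1 z c
  rw [one_smul] at h2
  rw [pMul_eq, h2, smul_pairAct, Lam, ← comul_mul_pLTwist hγ, pLTwist_qL k hS, mul_one,
    smul_mul_eq_pairAct (k := k)]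

lemma smul_pMul_smashRight {t : H} {γ : H →ₗ[k] k}
    (hS : Function.Bijective (𝒮 : H →ₗ[k] H)) (hγ : ∀ h, t * h = γ h • t) (a b c : A) (h : H) :
    t • pMul k H A (smashRight k γ a b h ⊗ₜ c) = t • pMul k H A (a ⊗ₜ smashLeft b h c) := by
  have key := ext_tmul₃ k H
    (f := (Algebra.lsmul k k A : H →ₐ[k] Module.End k A) t ∘ₗ
      (TensorProduct.curry (pMul k H A)).flip c ∘ₗ
      TensorProduct.lift
        ((Algebra.lsmul k k A : H →ₐ[k] Module.End k A).toLinearMap.flip.compl₁₂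
          (((TensorProduct.curry (pMul k H A)).flip b) ∘ₗ orbit k H a ∘ₗ antipodeInv k H)
          (antipodeInv k H ∘ₗ LinearMap.mul' k H ∘ₗ
            TensorProduct.map (LinearMap.mulRight k (Lam k γ) ∘ₗ 𝒮)
              (hit k γ ∘ₗ LinearMap.mulRight k h))))
    (g := (Algebra.lsmul k k A : H →ₐ[k] Module.End k A) t ∘ₗ
      tripleAct a b (h • c) ∘ₗ LinearMap.mulLeft k (assocElt k H) ∘ₗ twist₃ k (pL k H))
    (fun x y z => by
      change t • pMul k H A ((antipodeInv k H (𝒮 y * Lam k γ * hit k γ (z * h)) •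
          pMul k H A ((antipodeInv k H x • a) ⊗ₜ b)) ⊗ₜ c) =
        t • tripleAct a b (h • c) (assocElt k H * TensorProduct.assoc k H H H
          ((comul y * (pL k H * (antipodeInv k H x ⊗ₜ 1))) ⊗ₜ z))
      have h2 := pairAct_smul_smul (k := k) (pL k H) (antipodeInv k H x) 1 a b
      rw [one_smul] at h2
      -- The acting element is $S^{-1}(\gamma\rightharpoonup zh)\,S^{-1}(\Lambda)\,y$: its first
      -- factor moves to $c$ as $zh$, its second removes the outer $p_L$, and $y$ acts through
      -- $\Delta(y)$.
      rw [antipodeInv_mul hS, antipodeInv_mul hS, antipodeInv_antipode hS, mul_smul, mul_smul,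
        ← smul_pMul_smul hS hγ, smul_pMul_lam hS hγ, ← pairAct_mul_smul, ← smul_pairAct, ← h2,
        ← pMul_eq, mul_smul])
    (assocElt k H)
  refine key.trans ?_
  change t • tripleAct a b (h • c) (assocElt k H * twist₃ k (pL k H) (assocElt k H)) = _
  rw [assocElt_mul_twist₃ hS, ← pMul_tmul_mul, smashLeft]

lemma smul_mem_invariants {t : H} (ht : IsLeftIntegral k t) (a : A) :
    t • a ∈ invariants k H A := fun h => by
  rw [← mul_smul, ht h, smul_assoc]

lemma smul_mul_of_mem_invariants (h : H) (a : A) {b : A} (hb : b ∈ invariants k H A) :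
    h • (a * b) = (h • a) * b := by
  have hb' : ∀ g : H, g • b = counit (k := k) g • b := hb
  have : ∀ w : H ⊗[k] H, pairAct k H A w (a ⊗ₜ b) =
      (TensorProduct.rid k H (TensorProduct.map LinearMap.id counit.toLinearMap w) • a) * b := by
    intro w
    induction w with
    | zero => simp
    | add v w hv hw => simp only [map_add, LinearMap.add_apply, add_smul, add_mul, hv, hw]
    | tmul p q => simp [hb', mul_smul_comm, smul_mul_assoc]
  rw [smul_mul_eq_pairAct (k := k), this, counit_right]

lemma pMul_one_tmul (hS : Function.Bijective (𝒮 : H →ₗ[k] H)) (a : A) :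
    pMul k H A (1 ⊗ₜ a) = counit (k := k) (beta k : H) • a := by
  have : ∀ w : H ⊗[k] H, pairAct k H A w (1 ⊗ₜ a) =
      TensorProduct.lid k H (TensorProduct.map counit.toLinearMap LinearMap.id w) • a := by
    intro w
    induction w with
    | zero => simp
    | add v w hv hw => simp only [map_add, LinearMap.add_apply, add_smul, hv, hw]
    | tmul p q => simp [IsModuleAlgebra.smul_one' (k := k), smul_mul_assoc]
  rw [pMul_eq, this, lid_counit_pL hS, smul_assoc, one_smul]

lemma one_mem_invariants : (1 : A) ∈ invariants k H A := fun h =>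
  IsModuleAlgebra.smul_one' h

variable (A) in
/-- The Morita map, before passage to the tensor product over the smash product. -/
def preMoritaMap {t : H} (ht : IsLeftIntegral k t) : A ⊗[k] A →ₗ[k] invariants k H A :=
  LinearMap.codRestrict _ ((Algebra.lsmul k k A : H →ₐ[k] Module.End k A) t ∘ₗ pMul k H A)
    (fun _ => smul_mem_invariants ht _)

lemma smashRelations_le_ker [FiniteDimensional k H] {t : H} (ht : IsLeftIntegral k t)
    (ht0 : t ≠ 0) : smashRelations k A t ≤ LinearMap.ker (preMoritaMap A ht) := by
  rw [smashRelations, Submodule.span_le]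
  rintro _ ⟨a, b, c, h, rfl⟩
  rw [SetLike.mem_coe, LinearMap.mem_ker, map_sub, sub_eq_zero]
  exact Subtype.ext (smul_pMul_smashRight (antipode_bijective ht ht0)
    (ht.mul_eq_modular_smul ht0) a b c h)

variable (A) in
/-- The Morita map. -/
def moritaMap [FiniteDimensional k H] {t : H} (ht : IsLeftIntegral k t) (ht0 : t ≠ 0) :
    SmashTensor k A t →ₗ[k] invariants k H A :=
  (smashRelations k A t).liftQ (preMoritaMap A ht) (smashRelations_le_ker ht ht0)

lemma isMoritaMap_moritaMap [FiniteDimensional k H] {t : H} (ht : IsLeftIntegral k t)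
    (ht0 : t ≠ 0) : IsMoritaMap k A t (moritaMap A ht ht0) := fun _ _ => rfl

lemma exists_trace_one_of_surjective [FiniteDimensional k H] {t : H} (ht : IsLeftIntegral k t)
    (ht0 : t ≠ 0) (hs : Function.Surjective (moritaMap A ht ht0)) : ∃ a : A, t • a = 1 := by
  obtain ⟨z, hz⟩ := hs ⟨1, one_mem_invariants⟩
  obtain ⟨w, rfl⟩ := Submodule.mkQ_surjective _ z
  exact ⟨pMul k H A w, congrArg Subtype.val hz⟩

lemma surjective_of_trace_one [FiniteDimensional k H] {t : H} (ht : IsLeftIntegral k t)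
    (ht0 : t ≠ 0) {a : A} (ha : t • a = 1) : Function.Surjective (moritaMap A ht ht0) := by
  rintro ⟨b, hb⟩
  -- With $1$ in the first slot, $p_L$ contributes only $\varepsilon(\beta)$, leaving
  -- $t\cdot(ab)=(t\cdot a)b=b$.
  refine ⟨smashTmul k t 1 ((counit (k := k) (beta k : H))⁻¹ • (a * b)), Subtype.ext ?_⟩
  rw [isMoritaMap_moritaMap, pMul_one_tmul (antipode_bijective ht ht0), smul_smul,
    mul_inv_cancel₀ (counit_alpha_beta_ne_zero k H).2, one_smul,
    smul_mul_of_mem_invariants _ _ hb, ha, one_mul]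

lemma exists_trace_one_of_isTotalIntegral {t : H} (ht : IsLeftIntegral k t) (ht0 : t ≠ 0)
    {Φ : Module.Dual k H →ₗ[k] A} (hΦ : IsTotalIntegral k H A Φ) : ∃ a : A, t • a = 1 := by
  -- From $f(t)=1$ follows $f(gt)=\varepsilon(g)$, that is $t\rightharpoonup f=\varepsilon$.
  obtain ⟨f, hf⟩ := exists_dual_eq_one k ht0
  refine ⟨Φ f, ?_⟩
  rw [← hΦ.1, ← hΦ.2]
  congr 1
  ext g
  simp [ht g, hf]

lemma exists_isTotalIntegral_of_trace_one [FiniteDimensional k H] {t : H}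
    (ht : IsLeftIntegral k t) (ht0 : t ≠ 0) {a : A} (ha : t • a = 1) :
    ∃ Φ : Module.Dual k H →ₗ[k] A, IsTotalIntegral k H A Φ := by
  have hS := antipode_bijective ht ht0
  refine ⟨(counit (k := k) (alpha k : H))⁻¹ •
    orbit k H a ∘ₗ dualContract (qL k H * comul t), fun h f => ?_, ?_⟩
  · rw [LinearMap.smul_apply, LinearMap.comp_apply, ht.dualContract_mulRight hS,
      LinearMap.smul_apply, LinearMap.comp_apply, smul_comm h]
    congr 1
    exact mul_smul _ _ _
  · rw [LinearMap.smul_apply, LinearMap.comp_apply, dualContract_counit hS, map_smul, smul_smul,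
      inv_mul_cancel₀ (counit_alpha_beta_ne_zero k H).1, one_smul]
    exact ha

end Morita

end QuasiHopf

end

theorem mainTheorem4 {k : Type*} {H : Type*} {A : Type*}
    [Field k] [Ring H] [Algebra k H] [FiniteDimensional k H] [QuasiHopfAlgebra k H]
    [NonAssocRing A] [Module k A] [IsScalarTower k A A] [SMulCommClass k A A]
    [Module H A] [IsScalarTower k H A] [IsModuleAlgebra k H A]
    (t : H) (ht : IsLeftIntegral k t) (ht0 : t ≠ 0) :
    ∃ m : SmashTensor k A t →ₗ[k] invariants k H A, IsMoritaMap k A t m ∧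
      List.TFAE [
        Function.Surjective m,
        ∃ Φ : Module.Dual k H →ₗ[k] A, IsTotalIntegral k H A Φ,
        ∃ a : A, t • a = 1] := by
  refine ⟨moritaMap A ht ht0, isMoritaMap_moritaMap ht ht0, ?_⟩
  tfae_have 1 → 3 := exists_trace_one_of_surjective ht ht0
  tfae_have 3 → 1 := fun ⟨_, ha⟩ => surjective_of_trace_one ht ht0 ha
  tfae_have 2 → 3 := fun ⟨_, hΦ⟩ => exists_trace_one_of_isTotalIntegral ht ht0 hΦ
  tfae_have 3 → 2 := fun ⟨_, ha⟩ => exists_isTotalIntegral_of_trace_one ht ht0 ha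
  tfae_finish
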